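/- Consider a feedback loop with a linear single-input single-output controller $C(s)$ with realization $(A_C,B_C,C_C,D_C)$ and plant $P(s)$ with realization $(A_P,B_P,C_P,D_P)$. The controller is fed by $e=r-y$ and produces the first actuator input $u_1$, and the plant is fed by $z=v+d$ and produces $y$. The actuator is the bivariate saturation $v=\mathrm{sat}_{\alpha,\beta}(u_1,u_2)$, defined as follows. If $u_2\ge\max(-\beta,\alpha)$, its value is $\beta+u_2$ for $u_1>\beta+u_2$, $u_1$ for $\alpha-u_2\le u_1\le\beta+u_2$, and $\alpha-u_2$ for $u_1<\alpha-u_2$. If $u_2<\max(-\beta,\alpha)$, its value is $0$. The signals $r,d,u_2$ are $\mu_r+\sigma_r r_f$, $\mu_d+\sigma_d d_f$, $\mu_2+\sigma_2\beta_f$, where $r_f,d_f,\beta_f$ are outputs of linear coloring filters with realizations $(A_{rf},B_{rf},C_{rf},D_{rf})$, $(A_{df},B_{df},C_{df},D_{df})$, $(A_{\beta f},B_{\beta f},C_{\beta f},D_{\beta f})$ and $H_2$-norm $1$ (in particular, without direct feedthrough), driven by independent white noises. Assume $\sigma_r,\sigma_d\ge0$, not both $0$, and $\sigma_2>0$. The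 DC gains $C_{dc}=C(0)$, $P_{dc}=P(0)$ lie in $\mathbb R\cup\{\infty\}$ ($\infty$ if there is a pole at $0$) and are assumed nonzero; $1/\infty=0$. For $\mu_1\in\mathbb R$, $\sigma_1>0$, $|\rho|<1$ let $(u_1,u_2)$ be bivariate Gaussian with means $\mu_1,\mu_2$, standard deviations $\sigma_1,\sigma_2$ and correlation $\rho$, and put $$\mathcal F_{N_1}(\mu_1,\sigma_1,\rho)=E[\partial_{u_1}\mathrm{sat}_{\alpha,\beta}(u_1,u_2)],\quad \mathcal F_{N_2}(\mu_1,\sigma_1,\rho)=E[\partial_{u_2}\mathrm{sat}_{\alpha,\beta}(u_1,u_2)],\quad \mathcal F_{M}(\mu_1,\sigma_1,\rho)=E[\mathrm{sat}_{\alpha,\beta}(u_1,u_2)].$$ Let $\mathcal N_1,\mathcal N_2,\mathcal M$ be the ranges of these three functions and $\overline{\mathcal N}_1,\overline{\mathcal N}_2,\overline{\mathcal M}$ their closures. Quasilinearization replaces the actuator by $\hat v=N_1\hat u_1+N_2u_2+m$, with $m=M-N_1\mu_{\hat 1}-N_2\mu_2$. With $\Delta=1+D_CD_PN_1$, the zero-mean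 part of the resulting system, with state $x=(x_r,x_\beta,x_d,x_C,x_P)$ and input $w=(w_r,w_d,w_\beta)$, is $\dot x=\mathbf A x+\mathbf B w$, where $$\mathbf A=\begin{pmatrix}A_{rf}&0&0&0&0\\0&A_{\beta f}&0&0&0\\0&0&A_{df}&0&0\\ \frac{B_CC_{rf}\sigma_r}{\Delta}&-\frac{B_CC_{\beta f}D_PN_2\sigma_2}{\Delta}&-\frac{B_CC_{df}D_P\sigma_d}{\Delta}&A_C-\frac{B_CC_CD_PN_1}{\Delta}&-\frac{B_CC_P}{\Delta}\\ \frac{B_PC_{rf}D_CN_1\sigma_r}{\Delta}&\frac{B_PC_{\beta f}N_2\sigma_2}{\Delta}&\frac{B_PC_{df}\sigma_d}{\Delta}&\frac{B_PC_CN_1}{\Delta}&A_P-\frac{B_PC_PD_CN_1}{\Delta}\end{pmatrix},\qquad \mathbf B=\begin{pmatrix}B_{rf}&0&0\\0&0&B_{\beta f}\\0&B_{df}&0\\0&0&0\\0&0&0\end{pmatrix}.$$ The zero-mean parts of $\hat u_1$ and $u_2$ are $\mathbf C_1x$ and $\mathbf C_2x$ with $$\mathbf C_1=\tfrac1\Delta\left(C_{rf}D_C\sigma_r,\;-C_{\beta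 f}D_CD_PN_2\sigma_2,\;-C_{df}D_CD_P\sigma_d,\;C_C,\;-C_PD_C\right),\qquad \mathbf C_2=(0,\;C_{\beta f}\sigma_2,\;0,\;0,\;0).$$ Assume: 1. For all $N_1\in\overline{\mathcal N}_1$, $N_2\in\overline{\mathcal N}_2$ the matrix $\mathbf A$ is well defined ($\Delta\ne0$) and all its eigenvalues are in the open left half plane. 2. $\overline{\mathcal N}_1$, $\overline{\mathcal N}_2$ and $\overline{\mathcal M}$ are compact and convex. 3. If $C_{dc}=\infty$, then $\frac{\mu_r}{P_{dc}}-\mu_d\in\mathcal M$. If $P_{dc}=\infty$ but $C_{dc}\ne\infty$, then $-\mu_d\in\mathcal M$. 4. If $C_{dc}=\infty$ or $P_{dc}=\infty$ (or both), then there is a constant $d>0$ with $\left|\frac{\partial}{\partial\mu_1}\mathcal F_M(\mu_1,\sigma_1,\rho)\right|\ge d$ for all $\mu_1\in\mathbb R$, $\sigma_1>0$, $|\rho|<1$. Then the system of equations $$N_1=\mathcal F_{N_1}(\mu_{\hat1},\sigma_{\hat1},\rho),\qquad N_2=\mathcal F_{N_2}(\mu_{\hat1},\sigma_{\hat1},\rho),\qquad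 M=\mathcal F_M(\mu_{\hat1},\sigma_{\hat1},\rho),\qquad \frac{\mu_r}{P_{dc}}-\frac{\mu_{\hat1}}{C_{dc}P_{dc}}-\mu_d=\mathcal F_M(\mu_{\hat1},\sigma_{\hat1},\rho)$$ has a solution $N_1\in\overline{\mathcal N}_1$, $N_2\in\overline{\mathcal N}_2$, $M\in\overline{\mathcal M}$, with $\mu_{\hat1}\in\mathbb R$, $\sigma_{\hat1}>0$, $|\rho|<1$. Here $\mu_{\hat1},\sigma_{\hat1},\rho$ are tied to $N_1,N_2,M$ by $$\mu_{\hat1}=-\frac{m+\mu_d+N_2\mu_2-\frac{\mu_r}{P_{dc}}}{N_1+\frac1{C_{dc}P_{dc}}},\quad m=M-N_1\mu_{\hat1}-N_2\mu_2,\qquad \sigma_{\hat1}^2=\mathbf C_1\mathbf\Sigma\mathbf C_1^T,\qquad \rho=\frac{\mathbf C_1\mathbf\Sigma\mathbf C_2^T}{\sigma_{\hat1}\sigma_2},$$ where $\mathbf\Sigma$ solves the Lyapunov equation $\mathbf A\mathbf\Sigma+\mathbf\Sigma\mathbf A^T+\mathbf B\mathbf B^T=0$, and the denominator $N_1+\frac1{C_{dc}P_{dc}}$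 is nonzero. -/

import Mathlib

open MeasureTheory ProbabilityTheory Matrix Filter Topology

noncomputable section

namespace QLC

/-! ### Linear single-input single-output blocks -/

/-- A state-space realization `ẋ = A x + b w`, `y = c x + d w` of a single-input single-output
linear block with `n` states (`n = 0` is a static gain). -/
structure SISO (n : ℕ) where
  A : Matrix (Fin n) (Fin n) ℝ
  b : Fin n → ℝ
  c : Fin n → ℝ
  d : ℝ

/-- The transfer function `G(s) = c (sI - A)⁻¹ b + d` at a real point `s`. -/
def SISO.transfer {n : ℕ} (S : SISO n) (s : ℝ) : ℝ :=
  S.c ⬝ᵥ ((s • (1 : Matrix (Fin n) (Fin n) ℝ) - S.A)⁻¹ *ᵥ S.b) + S.d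

/-- `g` is the DC gain `G(0)` of the block, with the value `∞` when the transfer function has a
pole at the origin: it is the limit of `G(s)` as `s → 0` in the projective line `ℝ ∪ {∞}`.
(Only finitely many `s` make `sI - A` singular, and a rational function always has such a limit.) -/
def SISO.IsDCGain {n : ℕ} (S : SISO n) (g : OnePoint ℝ) : Prop :=
  Tendsto (fun s : ℝ => ((S.transfer s : ℝ) : OnePoint ℝ)) (𝓝[≠] (0 : ℝ)) (𝓝 g)

/-- The impulse response `c e^{tA} b` of the strictly proper part of the block. -/
def SISO.impulse {n : ℕ} (S : SISO n) (t : ℝ) : ℝ :=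
  S.c ⬝ᵥ (NormedSpace.exp (t • S.A) *ᵥ S.b)

/-- The block has `H₂`-norm one: there is no direct feedthrough (otherwise the `H₂`-norm is
infinite) and the impulse response has `L²(0, ∞)`-norm one. -/
def SISO.HasH2NormOne {n : ℕ} (S : SISO n) : Prop :=
  S.d = 0 ∧ ∫ t in Set.Ioi (0 : ℝ), S.impulse t ^ 2 = 1

/-- The reciprocal `1 / g` of a DC gain, with `1 / ∞ = 0`. -/
def recip (g : OnePoint ℝ) : ℝ := g.elim 0 (fun x => x⁻¹)

/-- All the eigenvalues of `A` are in the open left half plane. -/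
def IsHurwitz {ι : Type} [Fintype ι] [DecidableEq ι] (A : Matrix ι ι ℝ) : Prop :=
  ∀ z ∈ spectrum ℂ (A.map (algebraMap ℝ ℂ)), z.re < 0

/-! ### Bivariate saturation and bivariate Gaussian inputs -/

/-- The bivariate saturation `sat_{α,β}(u₁, u₂)`. -/
def sat (α β u₁ u₂ : ℝ) : ℝ :=
  if max (-β) α ≤ u₂ then
    if β + u₂ < u₁ then β + u₂ else if u₁ < α - u₂ then α - u₂ else u₁
  else 0

/-- The partial derivative of the saturation in `u₁` (given piecewise). -/
def satGrad₁ (α β u₁ u₂ : ℝ) : ℝ :=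
  if max (-β) α ≤ u₂ then
    if β + u₂ < u₁ then 0 else if u₁ < α - u₂ then 0 else 1
  else 0

/-- The partial derivative of the saturation in `u₂` (given piecewise). -/
def satGrad₂ (α β u₁ u₂ : ℝ) : ℝ :=
  if max (-β) α ≤ u₂ then
    if β + u₂ < u₁ then 1 else if u₁ < α - u₂ then -1 else 0
  else 0

/-- The bivariate Gaussian law with means `μ₁, μ₂`, standard deviations `σ₁, σ₂` and correlation
coefficient `ρ`, as the image of a pair of independent standard normal variables. -/
def biGaussian (μ₁ μ₂ σ₁ σ₂ ρ : ℝ) : Measure (ℝ × ℝ) :=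
  ((gaussianReal 0 1).prod (gaussianReal 0 1)).map
    (fun z => (μ₁ + σ₁ * (√(1 - ρ ^ 2) * z.1 + ρ * z.2), μ₂ + σ₂ * z.2))

/-! ### The closed loop -/

/-- The data of the feedback loop: coloring filters of the reference, of the second actuator
input and of the disturbance, controller `C`, plant `P`, means and standard deviations of the
exogenous signals, and the bounds `α`, `β` of the saturation. -/
structure Loop where
  /-- number of states of the coloring filter of the reference -/
  nr : ℕ
  /-- number of states of the coloring filter of the second actuator input -/
  nb : ℕ
  /-- number of states of the coloring filter of the disturbance -/
  nd : ℕ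
  /-- number of states of the controller -/
  nc : ℕ
  /-- number of states of the plant -/
  np : ℕ
  Fr : SISO nr
  Fb : SISO nb
  Fd : SISO nd
  C : SISO nc
  P : SISO np
  μr : ℝ
  σr : ℝ
  μd : ℝ
  σd : ℝ
  μ₂ : ℝ
  σ₂ : ℝ
  α : ℝ
  β : ℝ

namespace Loop

variable (L : Loop)

/-- Index type of the state vector `(x_r, x_β, x_d, x_C, x_P)`. -/
abbrev State : Type := Fin L.nr ⊕ Fin L.nb ⊕ Fin L.nd ⊕ Fin L.nc ⊕ Fin L.np

/-- The quantity `D_C D_P N₁ + 1` by which the closed-loop coefficients are divided. -/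
def den (N₁ : ℝ) : ℝ := L.C.d * L.P.d * N₁ + 1

/-- The state matrix `A` of the quasilinearized closed loop with gains `N₁`, `N₂`. -/
def matA (N₁ N₂ : ℝ) : Matrix L.State L.State ℝ
  | .inl i, .inl j => L.Fr.A i j
  | .inr (.inl i), .inr (.inl j) => L.Fb.A i j
  | .inr (.inr (.inl i)), .inr (.inr (.inl j)) => L.Fd.A i j
  | .inr (.inr (.inr (.inl i))), .inl j =>
      L.C.b i * L.Fr.c j * L.σr / L.den N₁
  | .inr (.inr (.inr (.inl i))), .inr (.inl j) =>
      -(L.C.b i * L.Fb.c j * L.P.d * N₂ * L.σ₂ / L.den N₁)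
  | .inr (.inr (.inr (.inl i))), .inr (.inr (.inl j)) =>
      -(L.C.b i * L.Fd.c j * L.P.d * L.σd / L.den N₁)
  | .inr (.inr (.inr (.inl i))), .inr (.inr (.inr (.inl j))) =>
      (L.C.A i j + L.C.A i j * L.C.d * L.P.d * N₁ - L.C.b i * L.C.c j * L.P.d * N₁) / L.den N₁
  | .inr (.inr (.inr (.inl i))), .inr (.inr (.inr (.inr j))) =>
      -(L.C.b i * L.P.c j / L.den N₁)
  | .inr (.inr (.inr (.inr i))), .inl j =>
      L.P.b i * L.Fr.c j * L.C.d * N₁ * L.σr / L.den N₁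
  | .inr (.inr (.inr (.inr i))), .inr (.inl j) =>
      L.P.b i * L.Fb.c j * N₂ * L.σ₂ / L.den N₁
  | .inr (.inr (.inr (.inr i))), .inr (.inr (.inl j)) =>
      L.P.b i * L.Fd.c j * L.σd / L.den N₁
  | .inr (.inr (.inr (.inr i))), .inr (.inr (.inr (.inl j))) =>
      L.P.b i * L.C.c j * N₁ / L.den N₁
  | .inr (.inr (.inr (.inr i))), .inr (.inr (.inr (.inr j))) =>
      (L.P.A i j + L.P.A i j * L.C.d * L.P.d * N₁ - L.P.b i * L.P.c j * L.C.d * N₁) / L.den N₁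
  | _, _ => 0

/-- The input matrix `B`; its columns belong to the independent white noises `w_r, w_d, w_β`. -/
def matB (N₁ N₂ : ℝ) : Matrix L.State (Fin 3) ℝ
  | .inl i => ![L.Fr.b i, 0, 0]
  | .inr (.inl i) => ![0, 0, L.Fb.b i]
  | .inr (.inr (.inl i)) => ![0, L.Fd.b i, 0]
  | .inr (.inr (.inr (.inl i))) =>
      ![L.C.b i * L.Fr.d * L.σr / L.den N₁,
        -(L.C.b i * L.Fd.d * L.P.d * L.σd / L.den N₁),
        -(L.C.b i * L.Fb.d * L.P.d * N₂ * L.σ₂ / L.den N₁)]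
  | .inr (.inr (.inr (.inr i))) =>
      ![L.P.b i * L.C.d * L.Fr.d * N₁ * L.σr / L.den N₁,
        L.P.b i * L.Fd.d * L.σd / L.den N₁,
        L.P.b i * L.Fb.d * N₂ * L.σ₂ / L.den N₁]

/-- The row `C₁`: the zero-mean part of the first actuator input is `C₁ x`. -/
def rowC₁ (N₁ N₂ : ℝ) : L.State → ℝ
  | .inl j => L.Fr.c j * L.C.d * L.σr / L.den N₁
  | .inr (.inl j) => -(L.Fb.c j * L.C.d * L.P.d * N₂ * L.σ₂ / L.den N₁)
  | .inr (.inr (.inl j)) => -(L.Fd.c j * L.C.d * L.P.d * L.σd / L.den N₁)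
  | .inr (.inr (.inr (.inl j))) => L.C.c j / L.den N₁
  | .inr (.inr (.inr (.inr j))) => -(L.P.c j * L.C.d / L.den N₁)

/-- The row `C₂`: the zero-mean part of the second actuator input is `C₂ x`. -/
def rowC₂ : L.State → ℝ
  | .inr (.inl j) => L.Fb.c j * L.σ₂
  | _ => 0

/-- `V` is a stationary state covariance: it solves the Lyapunov equation
`A V + V Aᵀ + B Bᵀ = 0`. -/
def IsStateCov (N₁ N₂ : ℝ) (V : Matrix L.State L.State ℝ) : Prop :=
  L.matA N₁ N₂ * V + V * (L.matA N₁ N₂)ᵀ + L.matB N₁ N₂ * (L.matB N₁ N₂)ᵀ = 0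

/-- `σ₁` is the (positive) standard deviation of the first actuator input and `ρ` the correlation
coefficient of the two actuator inputs, in the quasilinearized loop with gains `N₁`, `N₂`. -/
def IsInputStat (N₁ N₂ σ₁ ρ : ℝ) : Prop :=
  ∃ V : Matrix L.State L.State ℝ, L.IsStateCov N₁ N₂ V ∧
    0 < σ₁ ∧ σ₁ ^ 2 = L.rowC₁ N₁ N₂ ⬝ᵥ (V *ᵥ L.rowC₁ N₁ N₂) ∧
    ρ = L.rowC₁ N₁ N₂ ⬝ᵥ (V *ᵥ L.rowC₂) / (σ₁ * L.σ₂)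

/-- `μ₁` is the mean of the first actuator input, for the gains `N₁`, `N₂` and the bias `M`, where
`m = M - N₁ μ₁ - N₂ μ₂` is the constant added after the gains. -/
def IsInputMean (Cdc Pdc : OnePoint ℝ) (N₁ N₂ M μ₁ : ℝ) : Prop :=
  N₁ + recip Cdc * recip Pdc ≠ 0 ∧
  ∃ m : ℝ, m = M - N₁ * μ₁ - N₂ * L.μ₂ ∧
    μ₁ = -(m + L.μd + N₂ * L.μ₂ - recip Pdc * L.μr) / (N₁ + recip Cdc * recip Pdc)

/-- `F_{N₁}(μ₁, σ₁, ρ) = E[∂₁ sat(u₁, u₂)]`. -/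
def FN₁ (μ₁ σ₁ ρ : ℝ) : ℝ :=
  ∫ u, satGrad₁ L.α L.β u.1 u.2 ∂(biGaussian μ₁ L.μ₂ σ₁ L.σ₂ ρ)

/-- `F_{N₂}(μ₁, σ₁, ρ) = E[∂₂ sat(u₁, u₂)]`. -/
def FN₂ (μ₁ σ₁ ρ : ℝ) : ℝ :=
  ∫ u, satGrad₂ L.α L.β u.1 u.2 ∂(biGaussian μ₁ L.μ₂ σ₁ L.σ₂ ρ)

/-- `F_M(μ₁, σ₁, ρ) = E[sat(u₁, u₂)]`. -/
def FM (μ₁ σ₁ ρ : ℝ) : ℝ :=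
  ∫ u, sat L.α L.β u.1 u.2 ∂(biGaussian μ₁ L.μ₂ σ₁ L.σ₂ ρ)

end Loop

/-- The range of a function of `(μ₁, σ₁, ρ)` on its natural domain `σ₁ > 0`, `|ρ| < 1`. -/
def rangeOf (F : ℝ → ℝ → ℝ → ℝ) : Set ℝ :=
  {x | ∃ μ₁ σ₁ ρ : ℝ, 0 < σ₁ ∧ |ρ| < 1 ∧ F μ₁ σ₁ ρ = x}

end QLC

end

/-! The system is a fixed point problem in the two gains alone. For gains `(N₁, N₂)` in the product
of the closed ranges, `σ₁` and `ρ` come from the Lyapunov equation, `μ₁` from the mean equation, and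
`M` is then `F_M(μ₁, σ₁, ρ)`. The map sending the gains to the values of `F_{N₁}` and `F_{N₂}` at
these statistics takes the product into itself. By compactness and convexity the product is a
rectangle, so Brouwer's theorem in the plane applies once the map is continuous. It is proved here
from Sperner's lemma through Poincaré–Miranda.

Continuity rests on three facts.

Nondegeneracy (`quadForm_pos`): `σ₁ > 0` and `|ρ| < 1` for all admissible gains. Otherwise some
combination `u₁ + y u₂` would have zero variance. The noises of reference and disturbance never
reach `u₂`, so their responses in `u₁` would vanish. The closed-loop transfer identity excludes this
for a noise of positive intensity, because controller, plant and filters have nonzero transfer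
functions.

Solvability of the mean equation: with `K = 1/(C_dc P_dc)` it reads `F_M(μ₁, σ₁, ρ) + K μ₁ = c`. Its
slope in `μ₁` is `F_{N₁} + K`, since `∂F_M/∂μ₁ = F_{N₁}` (`hasDerivAt_FM`). If this is bounded away
from zero, the left side is an expanding bijection of the line, and its root depends continuously on
the gains (`exists_continuousOn_mean`).

The slope bound (`exists_le_abs_gain_add_recip`): for an infinite DC gain, `K = 0` and the assumed
derivative bound applies. For finite DC gains, `1 + N₁ C_dc P_dc = 0` would contradict stability of
the loop at zero frequency, and compactness makes the bound uniform. -/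

noncomputable section

namespace QLC

/-! ### A planar fixed point theorem -/

/-- The indicator, modulo two, of the edges whose end points carry the labels `0` and `1`. -/
def edgeParity (a b : Fin 3) : ZMod 2 :=
  if (a = 0 ∧ b = 1) ∨ (a = 1 ∧ b = 0) then 1 else 0

/-- If `2` is missing, a closed walk switches between `0` and `1` an even number of times; if `0` or
`1` is missing, no edge counts. -/
theorem edgeParity_triangle (a b c : Fin 3) :
    edgeParity a b + edgeParity b c + edgeParity a c = 0 ∨ ∀ k, k = a ∨ k = b ∨ k = c := by
  revert a b c; unfold edgeParity; decide

/-- The diagonal `a c` is shared by both triangles and cancels modulo two. The differences of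
opposite sides are arranged to telescope over the grid. -/
theorem edgeParity_square (a b c d : Fin 3)
    (h₁ : edgeParity a b + edgeParity b c + edgeParity a c = 0)
    (h₂ : edgeParity a d + edgeParity d c + edgeParity a c = 0) :
    (edgeParity d c - edgeParity a b) + (edgeParity b c - edgeParity a d) = 0 := by
  revert a b c d; unfold edgeParity; decide

theorem edgeParity_eq_zero_of_ne_one (a b : Fin 3) (ha : a ≠ 1) (hb : b ≠ 1) :
    edgeParity a b = 0 := by
  revert a b; unfold edgeParity; decide

theorem edgeParity_of_ne_two (a b : Fin 3) (ha : a ≠ 2) (hb : b ≠ 2) :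
    edgeParity a b = (if b = 1 then 1 else 0) - (if a = 1 then 1 else 0) := by
  revert a b; unfold edgeParity; decide

/-- Sperner's lemma on a square grid. -/
theorem exists_trichromatic_cell (n : ℕ) (l : ℕ → ℕ → Fin 3)
    (hright : ∀ j, l n j = 1) (htop : ∀ i, i < n → l i n = 2)
    (hleft : ∀ j, l 0 j ≠ 1) (hbot : ∀ i, l i 0 ≠ 2) :
    ∃ i < n, ∃ j < n, ∀ k, ∃ p ∈ Finset.Icc i (i + 1), ∃ q ∈ Finset.Icc j (j + 1), l p q = k := by
  by_contra hcon
  push Not at hcon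
  have hsum : ∑ i ∈ Finset.range n, ∑ j ∈ Finset.range n,
      ((edgeParity (l i (j + 1)) (l (i + 1) (j + 1)) - edgeParity (l i j) (l (i + 1) j)) +
        (edgeParity (l (i + 1) j) (l (i + 1) (j + 1)) - edgeParity (l i j) (l i (j + 1)))) = 0 := by
    refine Finset.sum_eq_zero fun i hi => Finset.sum_eq_zero fun j hj => ?_
    obtain ⟨k, hk⟩ := hcon i (Finset.mem_range.1 hi) j (Finset.mem_range.1 hj)
    have k1 := hk i (by simp) j (by simp)
    have k2 := hk (i + 1) (by simp) j (by simp)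
    have k3 := hk (i + 1) (by simp) (j + 1) (by simp)
    have k4 := hk i (by simp) (j + 1) (by simp)
    apply edgeParity_square
    · rcases edgeParity_triangle (l i j) (l (i + 1) j) (l (i + 1) (j + 1)) with h | h
      · exact h
      · rcases h k with h | h | h <;> simp_all
    · rcases edgeParity_triangle (l i j) (l i (j + 1)) (l (i + 1) (j + 1)) with h | h
      · exact h
      · rcases h k with h | h | h <;> simp_all
  simp only [Finset.sum_add_distrib] at hsum
  rw [Finset.sum_comm (f := fun i j => edgeParity (l (i + 1) j) (l (i + 1) (j + 1)) -
    edgeParity (l i j) (l i (j + 1)))] at hsum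
  -- Top edges start at a vertex labelled `2` and do not count. The bottom side has no `2`, so its
  -- edges telescope to the difference of the labels at its ends, which is odd. The vertical sides
  -- contribute nothing, and the boundary total cannot be zero.
  have e1 : ∀ i ∈ Finset.range n, ∑ j ∈ Finset.range n,
      (edgeParity (l i (j + 1)) (l (i + 1) (j + 1)) - edgeParity (l i j) (l (i + 1) j)) =
      - ((if l (i + 1) 0 = 1 then 1 else 0) - (if l i 0 = 1 then 1 else 0)) := by
    intro i hi
    rw [Finset.sum_range_sub (fun j => edgeParity (l i j) (l (i + 1) j)),
      edgeParity_of_ne_two _ _ (hbot i) (hbot (i + 1)), htop i (Finset.mem_range.1 hi)]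
    have : edgeParity 2 (l (i + 1) n) = 0 := by
      generalize l (i + 1) n = b
      revert b; unfold edgeParity; decide
    rw [this, zero_sub]
  have e2 : ∀ j ∈ Finset.range n, ∑ i ∈ Finset.range n,
      (edgeParity (l (i + 1) j) (l (i + 1) (j + 1)) - edgeParity (l i j) (l i (j + 1))) = 0 := by
    intro j _
    rw [Finset.sum_range_sub (fun i => edgeParity (l i j) (l i (j + 1))),
      edgeParity_eq_zero_of_ne_one _ _ (hleft j) (hleft (j + 1)), hright, hright]
    decide
  rw [Finset.sum_congr rfl e1, Finset.sum_congr rfl e2, Finset.sum_neg_distrib,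
    Finset.sum_range_sub (fun i => if l i 0 = 1 then (1 : ZMod 2) else 0), hright] at hsum
  simp [hleft 0] at hsum

/-- The planar Poincaré–Miranda theorem. -/
theorem exists_zero_of_signs (g₁ g₂ : ℝ × ℝ → ℝ)
    (hg₁ : ContinuousOn g₁ (Set.Icc 0 1 ×ˢ Set.Icc 0 1))
    (hg₂ : ContinuousOn g₂ (Set.Icc 0 1 ×ˢ Set.Icc 0 1))
    (h10 : ∀ y ∈ Set.Icc (0 : ℝ) 1, 0 ≤ g₁ (0, y)) (h11 : ∀ y ∈ Set.Icc (0 : ℝ) 1, g₁ (1, y) ≤ 0)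
    (h20 : ∀ x ∈ Set.Icc (0 : ℝ) 1, 0 ≤ g₂ (x, 0)) (h21 : ∀ x ∈ Set.Icc (0 : ℝ) 1, g₂ (x, 1) ≤ 0) :
    ∃ p ∈ Set.Icc (0 : ℝ) 1 ×ˢ Set.Icc (0 : ℝ) 1, g₁ p = 0 ∧ g₂ p = 0 := by
  set Q : Set (ℝ × ℝ) := Set.Icc 0 1 ×ˢ Set.Icc 0 1 with hQ
  have hQc : IsCompact Q := isCompact_Icc.prod isCompact_Icc
  -- Minimizing the larger absolute value makes a limit of Sperner cells unnecessary: a positive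
  -- minimum `ε` is contradicted by a single grid that is fine enough for `ε`.
  obtain ⟨p, hp, hmin⟩ := hQc.exists_isMinOn (f := fun p => max |g₁ p| |g₂ p|)
    ⟨(0, 0), by simp [hQ]⟩ (hg₁.abs.sup hg₂.abs)
  refine ⟨p, hp, ?_⟩
  by_contra hne
  have hε : 0 < max |g₁ p| |g₂ p| := by
    rw [lt_max_iff, abs_pos, abs_pos]; tauto
  set ε := max |g₁ p| |g₂ p|
  have hmin' : ∀ q ∈ Q, ε ≤ max |g₁ q| |g₂ q| := fun q hq => hmin hq
  obtain ⟨δ₁, hδ₁, hu₁⟩ := Metric.uniformContinuousOn_iff.1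
    (hQc.uniformContinuousOn_of_continuous hg₁) ε hε
  obtain ⟨δ₂, hδ₂, hu₂⟩ := Metric.uniformContinuousOn_iff.1
    (hQc.uniformContinuousOn_of_continuous hg₂) ε hε
  obtain ⟨m, hm⟩ := exists_nat_one_div_lt (lt_min hδ₁ hδ₂)
  set n := m + 1 with hn
  have hnpos : (0 : ℝ) < n := by positivity
  have hm' : 1 / (n : ℝ) < min δ₁ δ₂ := by rw [hn]; push_cast; exact hm
  let pt : ℕ → ℕ → ℝ × ℝ := fun i j => (i / n, j / n)
  have hpt : ∀ i ≤ n, ∀ j ≤ n, pt i j ∈ Q := by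
    intro i hi j hj
    have hi' : (i : ℝ) ≤ n := by exact_mod_cast hi
    have hj' : (j : ℝ) ≤ n := by exact_mod_cast hj
    refine ⟨⟨by positivity, ?_⟩, ⟨by positivity, ?_⟩⟩
    · exact (div_le_one hnpos).2 hi'
    · exact (div_le_one hnpos).2 hj'
  -- Label `0` forces both functions to be nonnegative, `1` forces `g₁ ≤ 0`, and `2` forces `g₂ ≤
  -- 0`. The right side is tested first, so it is labelled `1` up to and including the corner.
  let l : ℕ → ℕ → Fin 3 := fun i j =>
    if n ≤ i then 1 else if n ≤ j then 2 else
      if g₁ (pt i j) < 0 then 1 else if g₂ (pt i j) < 0 then 2 else 0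
  obtain ⟨i, hi, j, hj, hcell⟩ := exists_trichromatic_cell n l
    (fun j => by simp [l]) (fun i hi => by simp [l, hi.not_ge])
    (fun j => by
      by_cases hjn : n ≤ j
      · simp only [l, hjn, if_true, show ¬ (n ≤ 0) by omega, if_false]; decide
      · have : 0 ≤ g₁ (pt 0 j) := by
          have := h10 (j / n) (hpt 0 (by omega) j (by omega)).2
          simpa [pt] using this
        simp only [l, hjn, if_false, this.not_gt, show ¬ (n ≤ 0) by omega]
        split_ifs <;> decide)
    (fun i => by
      by_cases hin : i < n
      · have : 0 ≤ g₂ (pt i 0) := by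
          have := h20 (i / n) (hpt i hin.le 0 (by omega)).1
          simpa [pt] using this
        simp only [l, hin.not_ge, if_false, this.not_gt, show ¬ (n ≤ 0) by omega]
        split_ifs <;> decide
      · simp only [l, not_lt.1 hin, if_true]; decide)
  have hle : ∀ p ∈ Finset.Icc i (i + 1), p ≤ n := fun p hp => by
    have := (Finset.mem_Icc.1 hp).2; omega
  have hle' : ∀ p ∈ Finset.Icc j (j + 1), p ≤ n := fun p hp => by
    have := (Finset.mem_Icc.1 hp).2; omega
  obtain ⟨p₀, hp₀, q₀, hq₀, h0⟩ := hcell 0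
  obtain ⟨p₁, hp₁, q₁, hq₁, h1⟩ := hcell 1
  obtain ⟨p₂, hp₂, q₂, hq₂, h2⟩ := hcell 2
  have hm₀ := hpt p₀ (hle _ hp₀) q₀ (hle' _ hq₀)
  have hm₁ := hpt p₁ (hle _ hp₁) q₁ (hle' _ hq₁)
  have hm₂ := hpt p₂ (hle _ hp₂) q₂ (hle' _ hq₂)
  have s0 : 0 ≤ g₁ (pt p₀ q₀) ∧ 0 ≤ g₂ (pt p₀ q₀) := by
    simp only [l] at h0
    split_ifs at h0 with a b c d
    all_goals first | exact absurd h0 (by decide) | skip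
    exact ⟨not_lt.1 c, not_lt.1 d⟩
  have s1 : g₁ (pt p₁ q₁) ≤ 0 := by
    simp only [l] at h1
    split_ifs at h1 with a b c d
    all_goals first | exact absurd h1 (by decide) | skip
    · have := h11 _ hm₁.2
      have e : pt p₁ q₁ = (1, (pt p₁ q₁).2) := by
        simp [pt, le_antisymm (hle _ hp₁) a, hnpos.ne']
      rwa [e]
    · exact c.le
  have s2 : g₂ (pt p₂ q₂) ≤ 0 := by
    simp only [l] at h2
    split_ifs at h2 with a b c d
    all_goals first | exact absurd h2 (by decide) | skip
    · have := h21 _ hm₂.1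
      have e : pt p₂ q₂ = ((pt p₂ q₂).1, 1) := by
        have : q₂ = n := le_antisymm (hle' _ hq₂) b
        simp [pt, this, hnpos.ne']
      rwa [e]
    · exact d.le
  have hnear : ∀ k a b : ℕ, a ∈ Finset.Icc k (k + 1) → b ∈ Finset.Icc k (k + 1) →
      dist ((a : ℝ) / n) (b / n) ≤ 1 / n := by
    intro k a b ha hb
    rw [Finset.mem_Icc] at ha hb
    rw [Real.dist_eq, ← sub_div, abs_div, abs_of_pos hnpos]
    gcongr
    have ha1 : (k : ℝ) ≤ a := by exact_mod_cast ha.1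
    have ha2 : (a : ℝ) ≤ k + 1 := by exact_mod_cast ha.2
    have hb1 : (k : ℝ) ≤ b := by exact_mod_cast hb.1
    have hb2 : (b : ℝ) ≤ k + 1 := by exact_mod_cast hb.2
    rw [abs_le]; constructor <;> linarith
  have d1 : dist (pt p₀ q₀) (pt p₁ q₁) < δ₁ :=
    (max_le (hnear i _ _ hp₀ hp₁) (hnear j _ _ hq₀ hq₁)).trans_lt (hm'.trans_le (min_le_left _ _))
  have d2 : dist (pt p₀ q₀) (pt p₂ q₂) < δ₂ :=
    (max_le (hnear i _ _ hp₀ hp₂) (hnear j _ _ hq₀ hq₂)).trans_lt (hm'.trans_le (min_le_right _ _))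
  have b1 := hu₁ _ hm₀ _ hm₁ d1
  have b2 := hu₂ _ hm₀ _ hm₂ d2
  rw [Real.dist_eq, abs_lt] at b1 b2
  -- At the vertex labelled `0` both values are nonnegative and within `ε` of a nonpositive value,
  -- hence below the minimum `ε`.
  have := hmin' _ hm₀
  rw [abs_of_nonneg s0.1, abs_of_nonneg s0.2, le_max_iff] at this
  rcases this with h | h <;> linarith

/-- Brouwer's fixed point theorem on a rectangle. -/
theorem exists_fixedPoint_rectangle (f₁ f₂ : ℝ × ℝ → ℝ) (a b c d : ℝ) (hab : a ≤ b) (hcd : c ≤ d)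
    (hf₁ : ContinuousOn f₁ (Set.Icc a b ×ˢ Set.Icc c d))
    (hf₂ : ContinuousOn f₂ (Set.Icc a b ×ˢ Set.Icc c d))
    (hm₁ : ∀ p ∈ Set.Icc a b ×ˢ Set.Icc c d, f₁ p ∈ Set.Icc a b)
    (hm₂ : ∀ p ∈ Set.Icc a b ×ˢ Set.Icc c d, f₂ p ∈ Set.Icc c d) :
    ∃ p ∈ Set.Icc a b ×ˢ Set.Icc c d, f₁ p = p.1 ∧ f₂ p = p.2 := by
  let T : ℝ × ℝ → ℝ × ℝ := fun p => (a + (b - a) * p.1, c + (d - c) * p.2)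
  have hT : Continuous T := by fun_prop
  have hTm : Set.MapsTo T (Set.Icc 0 1 ×ˢ Set.Icc 0 1) (Set.Icc a b ×ˢ Set.Icc c d) := by
    rintro ⟨x, y⟩ ⟨⟨hx0, hx1⟩, ⟨hy0, hy1⟩⟩
    refine ⟨⟨?_, ?_⟩, ⟨?_, ?_⟩⟩ <;> simp only [T] at * <;> nlinarith
  have hc₁ := hf₁.comp hT.continuousOn hTm
  have hc₂ := hf₂.comp hT.continuousOn hTm
  have h0 : (0 : ℝ) ∈ Set.Icc (0 : ℝ) 1 := by simp
  have h1 : (1 : ℝ) ∈ Set.Icc (0 : ℝ) 1 := by simp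
  obtain ⟨p, hp, e₁, e₂⟩ := exists_zero_of_signs
    (fun p => f₁ (T p) - (T p).1) (fun p => f₂ (T p) - (T p).2)
    (hc₁.sub hT.fst.continuousOn) (hc₂.sub hT.snd.continuousOn)
    (fun y hy => by
      have := (hm₁ _ (hTm (Set.mk_mem_prod h0 hy))).1
      simp only [T] at *; linarith)
    (fun y hy => by
      have := (hm₁ _ (hTm (Set.mk_mem_prod h1 hy))).2
      simp only [T] at *; linarith)
    (fun x hx => by
      have := (hm₂ _ (hTm (Set.mk_mem_prod hx h0))).1
      simp only [T] at *; linarith)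
    (fun x hx => by
      have := (hm₂ _ (hTm (Set.mk_mem_prod hx h1))).2
      simp only [T] at *; linarith)
  exact ⟨T p, hTm hp, sub_eq_zero.1 e₁, sub_eq_zero.1 e₂⟩

/-! ### Matrix exponentials of Hurwitz matrices -/

section Exponential

attribute [local instance] Matrix.linftyOpNormedRing Matrix.linftyOpNormedAlgebra

variable {ι : Type} [Fintype ι] [DecidableEq ι]

theorem exp_smul_mulVec_of_pow_mulVec_eq_zero (N : Matrix ι ι ℂ) (x : ι → ℂ) (k : ℕ)
    (h : N ^ k *ᵥ x = 0) (t : ℝ) :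
    NormedSpace.exp (t • N) *ᵥ x =
      ∑ j ∈ Finset.range k, ((j.factorial : ℝ)⁻¹ * t ^ j) • (N ^ j *ᵥ x) := by
  have hs := NormedSpace.exp_series_hasSum_exp' (𝕂 := ℝ) (t • N)
  have hc : Continuous (fun X : Matrix ι ι ℂ => X *ᵥ x) := by fun_prop
  have hs' : HasSum (fun n : ℕ => ((n.factorial : ℝ)⁻¹ • (t • N) ^ n) *ᵥ x)
      (NormedSpace.exp (t • N) *ᵥ x) :=
    hs.map (⟨⟨fun X : Matrix ι ι ℂ => X *ᵥ x, by simp⟩, fun X Y => by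
      simp [add_mulVec]⟩ : Matrix ι ι ℂ →+ (ι → ℂ)) hc
  refine hs'.unique ?_
  have e : ∀ j, ((j.factorial : ℝ)⁻¹ • (t • N) ^ j) *ᵥ x =
      ((j.factorial : ℝ)⁻¹ * t ^ j) • (N ^ j *ᵥ x) := by
    intro j
    rw [smul_pow, smul_smul, smul_mulVec]
  have hz : ∀ j ∉ Finset.range k, ((j.factorial : ℝ)⁻¹ * t ^ j) • (N ^ j *ᵥ x) = 0 := by
    intro j hj
    obtain ⟨i, rfl⟩ := Nat.exists_eq_add_of_le (not_lt.1 (mt Finset.mem_range.2 hj))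
    rw [add_comm k i, pow_add N, ← mulVec_mulVec, h, mulVec_zero, smul_zero]
  rw [funext e]
  exact hasSum_sum_of_ne_finset_zero hz

theorem tendsto_exp_mul_pow (z : ℂ) (hz : z.re < 0) (j : ℕ) :
    Tendsto (fun t : ℝ => Complex.exp (t * z) * (t : ℂ) ^ j) atTop (𝓝 0) := by
  rw [tendsto_zero_iff_norm_tendsto_zero]
  have := tendsto_rpow_mul_exp_neg_mul_atTop_nhds_zero j (-z.re) (by linarith)
  refine this.congr' ?_
  filter_upwards [eventually_ge_atTop 0] with t ht
  rw [norm_mul, Complex.norm_exp, norm_pow, Complex.norm_real, Real.norm_of_nonneg ht]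
  simp [mul_comm]

theorem exp_smul_eq (M : Matrix ι ι ℂ) (z : ℂ) (t : ℝ) :
    NormedSpace.exp (t • M) =
      Complex.exp (t * z) • NormedSpace.exp (t • (M - algebraMap ℂ _ z)) := by
  have h1 : t • M = algebraMap ℂ (Matrix ι ι ℂ) (t * z) + t • (M - algebraMap ℂ _ z) := by
    rw [map_mul, smul_sub, Algebra.smul_def t (algebraMap ℂ (Matrix ι ι ℂ) z),
      IsScalarTower.algebraMap_apply ℝ ℂ (Matrix ι ι ℂ) t]
    simp
  rw [h1, Matrix.exp_add_of_commute _ _ (Algebra.commute_algebraMap_left _ _),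
    Complex.exp_eq_exp_ℂ,
    Algebra.smul_def (NormedSpace.exp ((t : ℂ) * z))]
  congr 1
  exact (NormedSpace.algebraMap_exp_comm (𝔸 := Matrix ι ι ℂ) ((t : ℂ) * z)).symm

/-- Generalized eigenvectors span the space over `ℂ`. On each of them the exponential is `e^{tz}`
times a polynomial in `t`, because the series of the nilpotent part terminates. -/
theorem tendsto_exp_smul_mulVec (M : Matrix ι ι ℂ) (hM : ∀ z ∈ spectrum ℂ M, z.re < 0)
    (v : ι → ℂ) : Tendsto (fun t : ℝ => NormedSpace.exp (t • M) *ᵥ v) atTop (𝓝 0) := by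
  have hv : v ∈ ⨆ z : ℂ, Module.End.maxGenEigenspace (Matrix.toLin' M) z := by
    rw [Module.End.iSup_maxGenEigenspace_eq_top]; trivial
  induction hv using Submodule.iSup_induction' with
  | mem z x hx =>
    obtain ⟨k, hk⟩ := (Module.End.mem_maxGenEigenspace _ _ _).1 hx
    have hk' : (M - algebraMap ℂ _ z) ^ k *ᵥ x = 0 := by
      rw [← hk, ← Matrix.toLin'_apply, Matrix.toLin'_pow, map_sub]
      congr 3
      ext; simp [Algebra.algebraMap_eq_smul_one]
    by_cases hz : z ∈ spectrum ℂ M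
    · have hz' := hM z hz
      simp_rw [exp_smul_eq M z, smul_mulVec,
        exp_smul_mulVec_of_pow_mulVec_eq_zero _ _ _ hk', Finset.smul_sum]
      rw [← Finset.sum_const_zero (s := Finset.range k)]
      refine tendsto_finsetSum _ fun j _ => ?_
      have := ((tendsto_exp_mul_pow z hz' j).mul_const
        ((j.factorial : ℂ)⁻¹)).smul_const ((M - algebraMap ℂ _ z) ^ j *ᵥ x)
      rw [zero_mul, zero_smul] at this
      refine this.congr fun t => ?_
      rw [← Complex.coe_smul, smul_smul]
      congr 1
      push_cast; ring
    · have hu : IsUnit (M - algebraMap ℂ _ z) := by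
        rw [spectrum.notMem_iff] at hz
        rw [← neg_sub]; exact hz.neg
      have hx0 : x = 0 := by
        have hinj := Matrix.mulVec_injective_of_isUnit (hu.pow k)
        exact hinj (by rw [hk', mulVec_zero])
      simp [hx0]
  | zero => simp
  | add x y _ _ hx hy =>
    simpa [mulVec_add] using hx.add hy

theorem IsHurwitz.tendsto_exp {A : Matrix ι ι ℝ} (hA : IsHurwitz A) :
    Tendsto (fun t : ℝ => NormedSpace.exp (t • A)) atTop (𝓝 0) := by
  have hmap : ∀ t : ℝ, (NormedSpace.exp (t • A)).map (algebraMap ℝ ℂ) =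
      NormedSpace.exp (t • A.map (algebraMap ℝ ℂ)) := by
    intro t
    have hc : Continuous ((algebraMap ℝ ℂ).mapMatrix : Matrix ι ι ℝ →+* Matrix ι ι ℂ) :=
      Continuous.matrix_map continuous_id Complex.continuous_ofReal
    refine (NormedSpace.map_exp (algebraMap ℝ ℂ).mapMatrix hc (t • A)).trans (congrArg _ ?_)
    ext i j
    simp
  refine tendsto_pi_nhds.2 fun i => tendsto_pi_nhds.2 fun j => ?_
  have h := tendsto_exp_smul_mulVec _ hA (Pi.single j 1)
  rw [tendsto_pi_nhds] at h
  have h' := (Complex.continuous_re.tendsto _).comp (h i)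
  simp only [Pi.zero_apply, Complex.zero_re] at h'
  refine h'.congr fun t => ?_
  rw [Function.comp_apply, ← hmap]
  simp

theorem hasDerivAt_exp_smul (A : Matrix ι ι ℝ) (t : ℝ) :
    HasDerivAt (fun t : ℝ => NormedSpace.exp (t • A)) (NormedSpace.exp (t • A) * A) t :=
  hasDerivAt_exp_smul_const A t

theorem hasDerivAt_exp_smul' (A : Matrix ι ι ℝ) (t : ℝ) :
    HasDerivAt (fun t : ℝ => NormedSpace.exp (t • A)) (A * NormedSpace.exp (t • A)) t :=
  hasDerivAt_exp_smul_const' A t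

theorem hasDerivAt_exp_mul_exp_transpose (A V : Matrix ι ι ℝ) (t : ℝ) :
    HasDerivAt (fun t : ℝ => NormedSpace.exp (t • A) * V * (NormedSpace.exp (t • A))ᵀ)
      (NormedSpace.exp (t • A) * (A * V + V * Aᵀ) * (NormedSpace.exp (t • A))ᵀ) t := by
  simp_rw [← Matrix.exp_transpose, Matrix.transpose_smul]
  have := ((hasDerivAt_exp_smul A t).mul_const V).mul (hasDerivAt_exp_smul' Aᵀ t)
  refine this.congr_deriv ?_
  simp only [mul_add, add_mul, mul_assoc]

theorem exp_smul_mulVec_mem {A : Matrix ι ι ℝ} (K : Submodule ℝ (ι → ℝ))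
    (hK : ∀ x ∈ K, A *ᵥ x ∈ K) {x : ι → ℝ} (hx : x ∈ K) (t : ℝ) :
    NormedSpace.exp (t • A) *ᵥ x ∈ K := by
  have hs := NormedSpace.exp_series_hasSum_exp' (𝕂 := ℝ) (t • A)
  have hc : Continuous (fun X : Matrix ι ι ℝ => X *ᵥ x) := by fun_prop
  have hs' : HasSum (fun n : ℕ => ((n.factorial : ℝ)⁻¹ • (t • A) ^ n) *ᵥ x)
      (NormedSpace.exp (t • A) *ᵥ x) :=
    hs.map (⟨⟨fun X : Matrix ι ι ℝ => X *ᵥ x, by simp⟩, fun X Y => by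
      simp [add_mulVec]⟩ : Matrix ι ι ℝ →+ (ι → ℝ)) hc
  have hpow : ∀ n : ℕ, A ^ n *ᵥ x ∈ K := by
    intro n
    induction n with
    | zero => simpa using hx
    | succ n ih => rw [pow_succ', ← mulVec_mulVec]; exact hK _ ih
  refine K.closed_of_finiteDimensional.mem_of_tendsto hs' (Eventually.of_forall fun s =>
    K.sum_mem fun n _ => ?_)
  rw [smul_pow, smul_smul, smul_mulVec]
  exact K.smul_mem _ (hpow n)

theorem mul_exp_smul_of_intertwine {κ : Type} [Fintype κ] [DecidableEq κ] {A : Matrix ι ι ℝ}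
    {A' : Matrix κ κ ℝ} {R : Matrix κ ι ℝ} (h : R * A = A' * R) (t : ℝ) :
    R * NormedSpace.exp (t • A) = NormedSpace.exp (t • A') * R := by
  have h₁ : HasSum (fun n : ℕ => R * ((n.factorial : ℝ)⁻¹ • (t • A) ^ n))
      (R * NormedSpace.exp (t • A)) :=
    (NormedSpace.exp_series_hasSum_exp' (𝕂 := ℝ) (t • A)).map
      (⟨⟨fun X : Matrix ι ι ℝ => R * X, by simp⟩, Matrix.mul_add R⟩ :
        Matrix ι ι ℝ →+ Matrix κ ι ℝ) (continuous_const.matrix_mul continuous_id)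
  have h₂ : HasSum (fun n : ℕ => ((n.factorial : ℝ)⁻¹ • (t • A') ^ n) * R)
      (NormedSpace.exp (t • A') * R) :=
    (NormedSpace.exp_series_hasSum_exp' (𝕂 := ℝ) (t • A')).map
      (⟨⟨fun X : Matrix κ κ ℝ => X * R, by simp⟩, fun X Y =>
        Matrix.add_mul X Y R⟩ : Matrix κ κ ℝ →+ Matrix κ ι ℝ)
        (continuous_id.matrix_mul continuous_const)
  have hpow : ∀ n : ℕ, R * A ^ n = A' ^ n * R := by
    intro n
    induction n with
    | zero => simp
    | succ n ih => rw [pow_succ, ← Matrix.mul_assoc, ih, Matrix.mul_assoc, h, ← Matrix.mul_assoc,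
        pow_succ]
  refine h₁.unique ?_
  convert h₂ using 2 with n
  rw [smul_pow, smul_pow, Matrix.mul_smul, Matrix.mul_smul, hpow, Matrix.smul_mul,
    Matrix.smul_mul]

theorem hasDerivAt_exp_smul_mulVec (A : Matrix ι ι ℝ) (v x : ι → ℝ) (t : ℝ) :
    HasDerivAt (fun t : ℝ => v ⬝ᵥ (NormedSpace.exp (t • A) *ᵥ x))
      (v ⬝ᵥ (NormedSpace.exp (t • A) *ᵥ (A *ᵥ x))) t := by
  have hL := (hasDerivAt_exp_smul A t)
  let φ : Matrix ι ι ℝ →ₗ[ℝ] ℝ :=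
    { toFun := fun X => v ⬝ᵥ (X *ᵥ x)
      map_add' := fun X Y => by simp [add_mulVec]
      map_smul' := fun r X => by simp [smul_mulVec] }
  have := (LinearMap.toContinuousLinearMap φ).hasFDerivAt.comp_hasDerivAt t hL
  rw [mulVec_mulVec]
  exact this

/-- The quadratic form of a solution of the Lyapunov equation, along the adjoint flow. -/
theorem hasDerivAt_energy {κ : Type} [Fintype κ] {A V : Matrix ι ι ℝ} {B : Matrix ι κ ℝ}
    (h : A * V + V * Aᵀ + B * Bᵀ = 0) (v : ι → ℝ) (t : ℝ) :
    HasDerivAt (fun t : ℝ =>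
        v ⬝ᵥ ((NormedSpace.exp (t • A) * V * (NormedSpace.exp (t • A))ᵀ) *ᵥ v))
      (-∑ k, (v ⬝ᵥ (NormedSpace.exp (t • A) *ᵥ B.col k)) ^ 2) t := by
  let φ : Matrix ι ι ℝ →ₗ[ℝ] ℝ :=
    { toFun := fun X => v ⬝ᵥ (X *ᵥ v)
      map_add' := fun X Y => by simp [add_mulVec]
      map_smul' := fun r X => by simp [smul_mulVec] }
  have := (LinearMap.toContinuousLinearMap φ).hasFDerivAt.comp_hasDerivAt t
    (hasDerivAt_exp_mul_exp_transpose A V t)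
  refine this.congr_deriv ?_
  set E := NormedSpace.exp (t • A)
  change v ⬝ᵥ ((E * (A * V + V * Aᵀ) * Eᵀ) *ᵥ v) = _
  rw [eq_neg_of_add_eq_zero_left h]
  have e : E * -(B * Bᵀ) * Eᵀ = -((E * B) * (E * B)ᵀ) := by
    rw [transpose_mul]; simp only [mul_neg, neg_mul, Matrix.mul_assoc]
  rw [e, neg_mulVec, dotProduct_neg, ← mulVec_mulVec, dotProduct_mulVec, mulVec_transpose,
    dotProduct]
  congr 1
  refine Finset.sum_congr rfl fun k _ => ?_
  rw [sq]
  rfl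

theorem IsHurwitz.tendsto_energy {A : Matrix ι ι ℝ} (hA : IsHurwitz A) (V : Matrix ι ι ℝ)
    (v : ι → ℝ) : Tendsto (fun t : ℝ =>
      v ⬝ᵥ ((NormedSpace.exp (t • A) * V * (NormedSpace.exp (t • A))ᵀ) *ᵥ v)) atTop (𝓝 0) := by
  have hc : Continuous (fun X : Matrix ι ι ℝ => v ⬝ᵥ ((X * V * Xᵀ) *ᵥ v)) := by fun_prop
  have := (hc.tendsto 0).comp hA.tendsto_exp
  rw [transpose_zero, mul_zero, zero_mulVec, dotProduct_zero] at this
  exact this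

/-- The curve `e^{tA} X e^{tAᵀ}` has zero derivative, starts at `X` and tends to zero. -/
theorem IsHurwitz.eq_zero_of_lyapunov {A X : Matrix ι ι ℝ} (hA : IsHurwitz A)
    (h : A * X + X * Aᵀ = 0) : X = 0 := by
  have hd := hasDerivAt_exp_mul_exp_transpose A X
  simp only [h, mul_zero, zero_mul] at hd
  have hconst := is_const_of_deriv_eq_zero (fun t => (hd t).differentiableAt)
    (fun t => (hd t).deriv)
  have hc : Continuous (fun Y : Matrix ι ι ℝ => Y * X * Yᵀ) := by fun_prop
  have hlim := (hc.tendsto 0).comp hA.tendsto_exp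
  have hX : ∀ t : ℝ, NormedSpace.exp (t • A) * X * (NormedSpace.exp (t • A))ᵀ = X := by
    intro t
    rw [hconst t 0]; simp
  refine tendsto_nhds_unique (f := fun _ : ℝ => X) tendsto_const_nhds ?_ (l := atTop)
  have := hlim.congr hX
  simpa using this

open Kronecker in
/-- The matrix of the operator `X ↦ A X + X Aᵀ`, acting on vectorized matrices. -/
def lyapunov (A : Matrix ι ι ℝ) : Matrix (ι × ι) (ι × ι) ℝ := 1 ⊗ₖ A + A ⊗ₖ 1

theorem lyapunov_mulVec_vec (A X : Matrix ι ι ℝ) :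
    lyapunov A *ᵥ X.vec = (A * X + X * Aᵀ).vec := by
  rw [lyapunov, add_mulVec, kronecker_mulVec_vec, kronecker_mulVec_vec, ← vec_add]
  simp

theorem IsHurwitz.isUnit_lyapunov {A : Matrix ι ι ℝ} (hA : IsHurwitz A) :
    IsUnit (lyapunov A).det := by
  rw [← Matrix.isUnit_iff_isUnit_det, ← Matrix.mulVec_injective_iff_isUnit]
  rw [← Matrix.coe_mulVecLin, ← LinearMap.ker_eq_bot, LinearMap.ker_eq_bot']
  intro y hy
  obtain ⟨X, rfl⟩ := Matrix.vec_bijective.2 y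
  rw [Matrix.mulVecLin_apply, lyapunov_mulVec_vec, ← vec_zero, vec_inj] at hy
  rw [hA.eq_zero_of_lyapunov hy, vec_zero]

theorem IsHurwitz.vec_eq_of_lyapunov {A Q V : Matrix ι ι ℝ} (hA : IsHurwitz A)
    (h : A * V + V * Aᵀ + Q = 0) : V.vec = (lyapunov A)⁻¹ *ᵥ (-Q).vec := by
  rw [← eq_neg_of_add_eq_zero_left h, ← lyapunov_mulVec_vec, mulVec_mulVec,
    Matrix.nonsing_inv_mul _ hA.isUnit_lyapunov, one_mulVec]

theorem IsHurwitz.exists_lyapunov {A : Matrix ι ι ℝ} (hA : IsHurwitz A) (Q : Matrix ι ι ℝ) :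
    ∃ V, A * V + V * Aᵀ + Q = 0 := by
  obtain ⟨V, hV⟩ := Matrix.vec_bijective.2 ((lyapunov A)⁻¹ *ᵥ (-Q).vec)
  refine ⟨V, ?_⟩
  rw [← neg_eq_iff_add_eq_zero, neg_eq_iff_eq_neg, ← vec_inj, ← lyapunov_mulVec_vec, hV,
    mulVec_mulVec, Matrix.mul_nonsing_inv _ hA.isUnit_lyapunov, one_mulVec]

/-- After vectorization the solution is unique and given by a matrix inverse, so any choice of
solutions is automatically continuous. -/
theorem continuousOn_lyapunov_solution {T : Type*} [TopologicalSpace T] {S : Set T}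
    {A Q V : T → Matrix ι ι ℝ} (hAc : ContinuousOn A S) (hQc : ContinuousOn Q S)
    (hA : ∀ p ∈ S, IsHurwitz (A p)) (hV : ∀ p ∈ S, A p * V p + V p * (A p)ᵀ + Q p = 0) :
    ContinuousOn V S := by
  have hlc : Continuous (lyapunov : Matrix ι ι ℝ → _) := by
    refine continuous_matrix fun p q => ?_
    simp only [lyapunov, Matrix.add_apply, kroneckerMap_apply]
    fun_prop
  have hinv : ContinuousOn (fun p => (lyapunov (A p))⁻¹) S := by
    intro p hp
    have hd := (hA p hp).isUnit_lyapunov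
    refine (continuousAt_matrix_inv _ ?_).comp_continuousWithinAt
      ((hlc.comp_continuousOn hAc) p hp)
    rw [Ring.inverse_eq_inv']
    exact continuousAt_inv₀ hd.ne_zero
  have hQv : ContinuousOn (fun p => (-Q p).vec) S := by
    have : Continuous (fun X : Matrix ι ι ℝ => (-X).vec) := by
      refine continuous_pi fun q => ?_
      simp only [vec, Matrix.neg_apply]
      fun_prop
    exact this.comp_continuousOn hQc
  have hVv : ContinuousOn (fun p => (V p).vec) S := by
    have hm : Continuous (fun z : Matrix (ι × ι) (ι × ι) ℝ × (ι × ι → ℝ) => z.1 *ᵥ z.2) := by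
      fun_prop
    exact (hm.comp_continuousOn (hinv.prodMk hQv)).congr
      fun p hp => (hA p hp).vec_eq_of_lyapunov (hV p hp)
  refine continuousOn_pi.2 fun i => continuousOn_pi.2 fun j => ?_
  exact continuousOn_pi.1 hVv (j, i)

end Exponential

/-! ### Quadratic forms of Lyapunov solutions -/

section Energy

variable {ι κ : Type} [Fintype ι] [DecidableEq ι] [Fintype κ]

theorem IsHurwitz.tendsto_integral_energy {A V : Matrix ι ι ℝ} {B : Matrix ι κ ℝ}
    (hA : IsHurwitz A) (h : A * V + V * Aᵀ + B * Bᵀ = 0) (v : ι → ℝ) :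
    Tendsto (fun T : ℝ => ∫ t in (0 : ℝ)..T,
      ∑ k, (v ⬝ᵥ (NormedSpace.exp (t • A) *ᵥ B.col k)) ^ 2) atTop (𝓝 (v ⬝ᵥ (V *ᵥ v))) := by
  have hcont : Continuous (fun t : ℝ => -∑ k, (v ⬝ᵥ (NormedSpace.exp (t • A) *ᵥ B.col k)) ^ 2) := by
    refine Continuous.neg (continuous_finsetSum _ fun k _ => Continuous.pow ?_ 2)
    exact continuous_iff_continuousAt.2 fun t => (hasDerivAt_exp_smul_mulVec A v _ t).continuousAt
  have hint : ∀ T : ℝ, ∫ t in (0 : ℝ)..T, ∑ k, (v ⬝ᵥ (NormedSpace.exp (t • A) *ᵥ B.col k)) ^ 2 =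
      v ⬝ᵥ (V *ᵥ v) -
        v ⬝ᵥ ((NormedSpace.exp (T • A) * V * (NormedSpace.exp (T • A))ᵀ) *ᵥ v) := by
    intro T
    have := intervalIntegral.integral_eq_sub_of_hasDerivAt (a := 0) (b := T)
      (fun t _ => hasDerivAt_energy h v t) (hcont.intervalIntegrable _ _)
    rw [intervalIntegral.integral_neg, neg_eq_iff_eq_neg, neg_sub] at this
    simpa using this
  simp_rw [hint]
  simpa using (hA.tendsto_energy V v).const_sub (v ⬝ᵥ (V *ᵥ v))

/-- The energy along the adjoint flow decreases to zero, hence is nonnegative. Starting at a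
nonpositive value it is identically zero for `t ≥ 0`, and its derivative is minus a sum of squares.
-/
theorem IsHurwitz.impulse_eq_zero_of_quadForm_nonpos {A V : Matrix ι ι ℝ} {B : Matrix ι κ ℝ}
    (hA : IsHurwitz A) (h : A * V + V * Aᵀ + B * Bᵀ = 0) {v : ι → ℝ}
    (hv : v ⬝ᵥ (V *ᵥ v) ≤ 0) {t : ℝ} (ht : 0 < t) (k : κ) :
    v ⬝ᵥ (NormedSpace.exp (t • A) *ᵥ B.col k) = 0 := by
  set φ : ℝ → ℝ := fun t =>
    v ⬝ᵥ ((NormedSpace.exp (t • A) * V * (NormedSpace.exp (t • A))ᵀ) *ᵥ v)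
  have hd : ∀ t, HasDerivAt φ _ t := fun t => hasDerivAt_energy h v t
  have hanti : Antitone φ := antitone_of_deriv_nonpos (fun t => (hd t).differentiableAt) fun t => by
    rw [(hd t).deriv]
    exact neg_nonpos.2 (Finset.sum_nonneg fun _ _ => sq_nonneg _)
  have h0 : φ 0 ≤ 0 := by simpa [φ] using hv
  have hnonneg : ∀ t, 0 ≤ φ t := fun t => hanti.le_of_tendsto (hA.tendsto_energy V v) t
  have hz : φ =ᶠ[𝓝 t] fun _ => 0 := by
    filter_upwards [lt_mem_nhds ht] with s hs
    exact le_antisymm ((hanti hs.le).trans h0) (hnonneg s)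
  have hsum := ((hd t).congr_of_eventuallyEq hz.symm).unique (hasDerivAt_const t (0 : ℝ))
  rw [neg_eq_zero, Finset.sum_eq_zero_iff_of_nonneg (fun _ _ => sq_nonneg _)] at hsum
  exact pow_eq_zero_iff two_ne_zero |>.1 (hsum k (Finset.mem_univ k))

theorem IsHurwitz.isSymm_of_lyapunov {A V : Matrix ι ι ℝ} {B : Matrix ι κ ℝ}
    (hA : IsHurwitz A) (h : A * V + V * Aᵀ + B * Bᵀ = 0) : Vᵀ = V := by
  refine sub_eq_zero.1 (hA.eq_zero_of_lyapunov ?_)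
  have ht := congrArg transpose h
  simp only [transpose_add, transpose_mul, transpose_transpose, transpose_zero] at ht
  have : A * (Vᵀ - V) + (Vᵀ - V) * Aᵀ =
      (V * Aᵀ + A * V + B * Bᵀ)ᵀ - (A * V + V * Aᵀ + B * Bᵀ) := by
    simp only [transpose_add, transpose_mul, transpose_transpose, mul_sub, sub_mul]
    abel
  rw [this, h, add_comm (V * Aᵀ), h]
  simp

end Energy

/-! ### Resolvents -/

section Resolvent

variable {ι : Type} [Fintype ι] [DecidableEq ι]

theorem eventually_isUnit_det_smul_one_sub (A : Matrix ι ι ℝ) (a : ℝ) :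
    ∀ᶠ s in 𝓝[≠] a, IsUnit (s • (1 : Matrix ι ι ℝ) - A).det := by
  have hfin : {s : ℝ | A.charpoly.IsRoot s}.Finite :=
    Polynomial.finite_setOfPred_isRoot A.charpoly_monic.ne_zero
  filter_upwards [nhdsNE_le_cofinite a hfin.compl_mem_cofinite] with s hs
  rw [isUnit_iff_ne_zero]
  intro h0
  apply hs
  change A.charpoly.eval s = 0
  rw [Matrix.eval_charpoly, ← h0, smul_one_eq_diagonal]
  rfl

theorem IsHurwitz.isUnit_det_smul_one_sub {A : Matrix ι ι ℝ} (hA : IsHurwitz A) {s : ℝ}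
    (hs : 0 ≤ s) : IsUnit (s • (1 : Matrix ι ι ℝ) - A).det := by
  by_contra hcon
  have : (s : ℂ) ∈ spectrum ℂ (A.map (algebraMap ℝ ℂ)) := by
    rw [spectrum.mem_iff, Matrix.isUnit_iff_isUnit_det]
    intro hu
    apply hcon
    have e : algebraMap ℂ (Matrix ι ι ℂ) s - A.map (algebraMap ℝ ℂ) =
        (algebraMap ℝ ℂ).mapMatrix (s • (1 : Matrix ι ι ℝ) - A) := by
      ext i j
      simp only [Matrix.algebraMap_matrix_apply, Matrix.one_apply, Matrix.sub_apply,
        Matrix.smul_apply, Matrix.map_apply, RingHom.mapMatrix_apply, map_sub, smul_eq_mul,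
        mul_ite, mul_one, mul_zero]
      split_ifs <;> simp
    rw [e, ← RingHom.map_det, isUnit_iff_ne_zero] at hu
    rw [isUnit_iff_ne_zero]
    intro h0
    simp [h0] at hu
  have := hA _ this
  simp at this
  linarith

theorem continuousAt_resolvent_mulVec {A : Matrix ι ι ℝ} {s : ℝ}
    (hs : IsUnit (s • (1 : Matrix ι ι ℝ) - A).det) (x : ι → ℝ) :
    ContinuousAt (fun s : ℝ => (s • (1 : Matrix ι ι ℝ) - A)⁻¹ *ᵥ x) s := by
  have hc : Continuous (fun X : Matrix ι ι ℝ => X *ᵥ x) := by fun_prop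
  have h1 : ContinuousAt (fun s : ℝ => (s • (1 : Matrix ι ι ℝ) - A)⁻¹) s := by
    refine (continuousAt_matrix_inv _ ?_).comp (f := fun s : ℝ => s • (1 : Matrix ι ι ℝ) - A)
      (by fun_prop)
    rw [Ring.inverse_eq_inv']
    exact continuousAt_inv₀ hs.ne_zero
  exact hc.continuousAt.comp h1

theorem inv_mulVec_mem {X : Matrix ι ι ℝ} (K : Submodule ℝ (ι → ℝ))
    (hK : ∀ x ∈ K, X *ᵥ x ∈ K) (hX : IsUnit X.det) {x : ι → ℝ} (hx : x ∈ K) : X⁻¹ *ᵥ x ∈ K := by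
  let f : K →ₗ[ℝ] K := X.mulVecLin.restrict hK
  have hinj : Function.Injective f := by
    intro a b hab
    have hab' : X *ᵥ a = X *ᵥ b := congrArg Subtype.val hab
    exact Subtype.ext (Matrix.mulVec_injective_of_isUnit
      ((Matrix.isUnit_iff_isUnit_det X).2 hX) hab')
  obtain ⟨y, hy⟩ := LinearMap.injective_iff_surjective.1 hinj ⟨x, hx⟩
  have hy' : X *ᵥ y = x := congrArg Subtype.val hy
  rw [← hy', mulVec_mulVec, Matrix.nonsing_inv_mul _ hX, one_mulVec]
  exact y.2

/-- If the impulse response vanishes then so does the transfer function. -/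
theorem resolvent_eq_zero_of_exp_eq_zero {A : Matrix ι ι ℝ} {v b : ι → ℝ}
    (h : ∀ t : ℝ, 0 < t → v ⬝ᵥ (NormedSpace.exp (t • A) *ᵥ b) = 0) {s : ℝ}
    (hs : IsUnit (s • (1 : Matrix ι ι ℝ) - A).det) :
    v ⬝ᵥ ((s • (1 : Matrix ι ι ℝ) - A)⁻¹ *ᵥ b) = 0 := by
  -- Differentiation in `t` shows that this unobservable subspace is `A`-invariant, hence invariant
  -- under the resolvent. Letting `t → 0⁺` for the resolvent image of `b` gives the claim without a
  -- Laplace integral.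
  let K : Submodule ℝ (ι → ℝ) :=
    { carrier := {x | ∀ t : ℝ, 0 < t → v ⬝ᵥ (NormedSpace.exp (t • A) *ᵥ x) = 0}
      add_mem' := fun {x y} hx hy t ht => by
        rw [mulVec_add, dotProduct_add, hx t ht, hy t ht, add_zero]
      zero_mem' := fun t _ => by simp
      smul_mem' := fun r x hx t ht => by rw [mulVec_smul, dotProduct_smul, hx t ht, smul_zero] }
  have hKA : ∀ x ∈ K, A *ᵥ x ∈ K := by
    intro x hx t ht
    have hz : (fun t : ℝ => v ⬝ᵥ (NormedSpace.exp (t • A) *ᵥ x)) =ᶠ[𝓝 t] fun _ => 0 := by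
      filter_upwards [lt_mem_nhds ht] with r hr using hx r hr
    exact ((hasDerivAt_exp_smul_mulVec A v x t).congr_of_eventuallyEq hz.symm).unique
      (hasDerivAt_const t (0 : ℝ))
  have hKs : ∀ x ∈ K, (s • (1 : Matrix ι ι ℝ) - A) *ᵥ x ∈ K := fun x hx => by
    rw [sub_mulVec, smul_mulVec, one_mulVec]
    exact K.sub_mem (K.smul_mem _ hx) (hKA x hx)
  have hmem := inv_mulVec_mem K hKs hs h
  set y := (s • (1 : Matrix ι ι ℝ) - A)⁻¹ *ᵥ b
  have hc := (hasDerivAt_exp_smul_mulVec A v y 0).continuousAt.tendsto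
  simp only [zero_smul, NormedSpace.exp_zero, one_mulVec] at hc
  refine tendsto_nhds_unique (hc.mono_left (nhdsWithin_le_nhds (s := Set.Ioi 0))) ?_
  refine (tendsto_congr' ?_).2 tendsto_const_nhds
  filter_upwards [self_mem_nhdsWithin] with t ht using hmem t ht

/-- If the transfer function vanishes near the origin then so does the impulse response. -/
theorem exp_eq_zero_of_resolvent_eq_zero {A : Matrix ι ι ℝ} {c b : ι → ℝ}
    (h : ∀ᶠ s in 𝓝[≠] (0 : ℝ), c ⬝ᵥ ((s • (1 : Matrix ι ι ℝ) - A)⁻¹ *ᵥ b) = 0) (t : ℝ) :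
    c ⬝ᵥ (NormedSpace.exp (t • A) *ᵥ b) = 0 := by
  obtain ⟨ε, hε, hU⟩ := Metric.mem_nhdsWithin_iff.1
    (h.and (eventually_isUnit_det_smul_one_sub A 0))
  set U : Set ℝ := Metric.ball 0 ε ∩ {0}ᶜ
  have hUo : IsOpen U := Metric.isOpen_ball.inter isOpen_compl_singleton
  let R : ℝ → Matrix ι ι ℝ := fun s => (s • (1 : Matrix ι ι ℝ) - A)⁻¹
  have hunit : ∀ s ∈ U, IsUnit (s • (1 : Matrix ι ι ℝ) - A).det := fun s hs => (hU hs).2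
  -- The resolvent identity makes `K` invariant under every `R s` with `s ∈ U`. Inverting one of
  -- them makes `K` invariant under `A`, and `c` vanishes on `K`.
  let K : Submodule ℝ (ι → ℝ) :=
    { carrier := {x | ∀ s ∈ U, c ⬝ᵥ (R s *ᵥ x) = 0}
      add_mem' := fun {x y} hx hy t ht => by
        rw [mulVec_add, dotProduct_add, hx t ht, hy t ht, add_zero]
      zero_mem' := fun t _ => by simp
      smul_mem' := fun r x hx t ht => by rw [mulVec_smul, dotProduct_smul, hx t ht, smul_zero] }
  have hb : b ∈ K := fun s hs => (hU hs).1
  have hRK : ∀ s ∈ U, ∀ x ∈ K, R s *ᵥ x ∈ K := by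
    intro s hs x hx
    have hne : ∀ r ∈ U, r ≠ s → c ⬝ᵥ (R r *ᵥ (R s *ᵥ x)) = 0 := by
      intro r hr hrs
      have e : (s - r) • (R r *ᵥ (R s *ᵥ x)) = R r *ᵥ x - R s *ᵥ x := by
        have : R r * ((s • 1 - A) - (r • 1 - A)) * R s = R r - R s := by
          rw [mul_sub, sub_mul, Matrix.mul_assoc, Matrix.mul_nonsing_inv _ (hunit s hs),
            Matrix.nonsing_inv_mul _ (hunit r hr), mul_one, one_mul]
        rw [← sub_mulVec, ← this, sub_sub_sub_cancel_right, ← sub_smul, mul_smul_comm, mul_one,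
          smul_mul_assoc, smul_mulVec, mulVec_mulVec]
      have := congrArg (c ⬝ᵥ ·) e
      simp only [dotProduct_smul, dotProduct_sub, hx r hr, hx s hs, sub_zero, smul_eq_mul,
        mul_eq_zero, sub_eq_zero] at this
      exact this.resolve_left (Ne.symm hrs)
    intro r hr
    by_cases hrs : r = s
    -- The resolvent identity says nothing at equal frequencies; continuity of the resolvent fills
    -- the gap.
    · subst hrs
      have hc := continuousAt_resolvent_mulVec (hunit r hr) (R r *ᵥ x)
      have hc' : ContinuousAt (fun s => c ⬝ᵥ (R s *ᵥ (R r *ᵥ x))) r :=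
        ContinuousAt.comp (g := fun z => c ⬝ᵥ z) (by fun_prop) hc
      refine tendsto_nhds_unique (hc'.tendsto.mono_left (nhdsWithin_le_nhds (s := {r}ᶜ))) ?_
      refine (tendsto_congr' ?_).2 tendsto_const_nhds
      filter_upwards [self_mem_nhdsWithin, nhdsWithin_le_nhds (hUo.mem_nhds hr)] with q hq hq'
      exact hne q hq' hq
    · exact hne r hr hrs
  obtain ⟨s, hs⟩ : U.Nonempty := by
    refine ⟨ε / 2, ?_, ?_⟩
    · rw [Metric.mem_ball, dist_zero_right, Real.norm_of_nonneg (by positivity)]; linarith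
    · simp [hε.ne']
  have hRdet : IsUnit (R s).det := Matrix.isUnit_nonsing_inv_det _ (hunit s hs)
  have hinv : (R s)⁻¹ = s • 1 - A := Matrix.nonsing_inv_nonsing_inv _ (hunit s hs)
  have hsK : ∀ x ∈ K, (s • 1 - A) *ᵥ x ∈ K := fun x hx => by
    have := inv_mulVec_mem K (hRK s hs) hRdet hx
    rwa [hinv] at this
  have hKA : ∀ x ∈ K, A *ᵥ x ∈ K := fun x hx => by
    have := K.sub_mem (K.smul_mem s hx) (hsK x hx)
    rwa [sub_mulVec, smul_mulVec, one_mulVec, sub_sub_cancel] at this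
  have hc : ∀ x ∈ K, c ⬝ᵥ x = 0 := fun x hx => by
    have := hsK x hx s hs
    rwa [mulVec_mulVec, Matrix.nonsing_inv_mul _ (hunit s hs), one_mulVec] at this
  exact hc _ (exp_smul_mulVec_mem K hKA hb t)

end Resolvent

/-! ### Linear blocks -/

namespace SISO

variable {n : ℕ} (S : SISO n)

/-- The state response `(sI - A)⁻¹ b` at a real frequency. -/
def resp (s : ℝ) : Fin n → ℝ := (s • (1 : Matrix (Fin n) (Fin n) ℝ) - S.A)⁻¹ *ᵥ S.b

theorem transfer_eq (s : ℝ) : S.transfer s = S.c ⬝ᵥ S.resp s + S.d := rfl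

variable {S}

theorem IsDCGain.eventually_ne_zero {g : OnePoint ℝ} (h : S.IsDCGain g)
    (hg : g ≠ ((0 : ℝ) : OnePoint ℝ)) : ∀ᶠ s in 𝓝[≠] (0 : ℝ), S.transfer s ≠ 0 := by
  filter_upwards [h.eventually_ne hg] with s hs h0
  exact hs (by rw [h0])

theorem HasH2NormOne.frequently_ne_zero (h : S.HasH2NormOne) :
    ¬ ∀ᶠ s in 𝓝[≠] (0 : ℝ), S.c ⬝ᵥ S.resp s = 0 := by
  intro hz
  have h0 : ∀ t, S.impulse t = 0 := exp_eq_zero_of_resolvent_eq_zero hz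
  have := h.2
  simp [h0] at this

theorem HasH2NormOne.tendsto_integral (h : S.HasH2NormOne) :
    Tendsto (fun T : ℝ => ∫ t in (0 : ℝ)..T, S.impulse t ^ 2) atTop (𝓝 1) := by
  -- A nonintegrable function has integral `0` by convention, so the value `1` forces integrability.
  have hint : IntegrableOn (fun t => S.impulse t ^ 2) (Set.Ioi 0) := by
    by_contra hcon
    have := h.2
    rw [integral_undef hcon] at this
    exact zero_ne_one this
  have := intervalIntegral_tendsto_integral_Ioi 0 hint tendsto_id
  rwa [h.2] at this

end SISO

/-! ### The closed loop in block coordinates and its transfer identity -/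

namespace Loop

variable (L : Loop)

/-- The blocks of a state vector. -/
def toBlocks (br : Fin L.nr → ℝ) (bb : Fin L.nb → ℝ) (bd : Fin L.nd → ℝ) (bc : Fin L.nc → ℝ)
    (bp : Fin L.np → ℝ) : L.State → ℝ :=
  Sum.elim br (Sum.elim bb (Sum.elim bd (Sum.elim bc bp)))

theorem exists_toBlocks (x : L.State → ℝ) : ∃ xr xb xd xc xp, x = L.toBlocks xr xb xd xc xp := by
  refine ⟨fun i => x (.inl i), fun i => x (.inr (.inl i)), fun i => x (.inr (.inr (.inl i))),
    fun i => x (.inr (.inr (.inr (.inl i)))), fun i => x (.inr (.inr (.inr (.inr i)))), ?_⟩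
  ext i
  rcases i with i | i | i | i | i <;> rfl

variable {L}

theorem toBlocks_inj {xr yr : Fin L.nr → ℝ} {xb yb : Fin L.nb → ℝ} {xd yd : Fin L.nd → ℝ}
    {xc yc : Fin L.nc → ℝ} {xp yp : Fin L.np → ℝ}
    (h : L.toBlocks xr xb xd xc xp = L.toBlocks yr yb yd yc yp) :
    xr = yr ∧ xb = yb ∧ xd = yd ∧ xc = yc ∧ xp = yp :=
  ⟨funext fun i => congrFun h (.inl i), funext fun i => congrFun h (.inr (.inl i)),
    funext fun i => congrFun h (.inr (.inr (.inl i))),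
    funext fun i => congrFun h (.inr (.inr (.inr (.inl i)))),
    funext fun i => congrFun h (.inr (.inr (.inr (.inr i))))⟩

theorem toBlocks_add (xr yr : Fin L.nr → ℝ) (xb yb : Fin L.nb → ℝ) (xd yd : Fin L.nd → ℝ)
    (xc yc : Fin L.nc → ℝ) (xp yp : Fin L.np → ℝ) :
    L.toBlocks xr xb xd xc xp + L.toBlocks yr yb yd yc yp =
      L.toBlocks (xr + yr) (xb + yb) (xd + yd) (xc + yc) (xp + yp) := by
  ext i; rcases i with i | i | i | i | i <;> rfl

theorem smul_toBlocks (s : ℝ) (xr : Fin L.nr → ℝ) (xb : Fin L.nb → ℝ) (xd : Fin L.nd → ℝ)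
    (xc : Fin L.nc → ℝ) (xp : Fin L.np → ℝ) :
    s • L.toBlocks xr xb xd xc xp = L.toBlocks (s • xr) (s • xb) (s • xd) (s • xc) (s • xp) := by
  ext i; rcases i with i | i | i | i | i <;> rfl

variable (L)

/-- The input of the controller, in terms of the filter outputs `w = σ_r r_f` and
`q = N₂ σ₂ β_f + σ_d d_f` and of the states of controller and plant. -/
def errorSignal (N₁ w q : ℝ) (xc : Fin L.nc → ℝ) (xp : Fin L.np → ℝ) : ℝ :=
  (w - L.P.d * q - L.P.d * N₁ * (L.C.c ⬝ᵥ xc) - L.P.c ⬝ᵥ xp) / L.den N₁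

/-- The input of the plant. -/
def plantInput (N₁ w q : ℝ) (xc : Fin L.nc → ℝ) (xp : Fin L.np → ℝ) : ℝ :=
  (L.C.d * N₁ * w + q + N₁ * (L.C.c ⬝ᵥ xc) - L.C.d * N₁ * (L.P.c ⬝ᵥ xp)) / L.den N₁

/-- The output of the controller. -/
def controlSignal (N₁ w q : ℝ) (xc : Fin L.nc → ℝ) (xp : Fin L.np → ℝ) : ℝ :=
  (L.C.d * w - L.C.d * L.P.d * q + L.C.c ⬝ᵥ xc - L.C.d * (L.P.c ⬝ᵥ xp)) / L.den N₁

variable {L}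

theorem sum_mul_mul_eq {n : ℕ} (f c x : Fin n → ℝ) (k : ℝ) (h : ∀ j, f j = k * c j) :
    ∑ j, f j * x j = k * (c ⬝ᵥ x) := by
  rw [dotProduct, Finset.mul_sum]
  exact Finset.sum_congr rfl fun j _ => by rw [h]; ring

theorem sum_sub_mul_eq {n : ℕ} (f a c x : Fin n → ℝ) (k : ℝ) (h : ∀ j, f j = a j - k * c j) :
    ∑ j, f j * x j = a ⬝ᵥ x - k * (c ⬝ᵥ x) := by
  simp only [h, sub_mul, Finset.sum_sub_distrib, dotProduct, Finset.mul_sum, mul_assoc]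

theorem matA_mulVec_toBlocks {N₁ N₂ : ℝ} (hden : L.den N₁ ≠ 0) (xr : Fin L.nr → ℝ)
    (xb : Fin L.nb → ℝ) (xd : Fin L.nd → ℝ) (xc : Fin L.nc → ℝ) (xp : Fin L.np → ℝ) :
    L.matA N₁ N₂ *ᵥ L.toBlocks xr xb xd xc xp =
      L.toBlocks (L.Fr.A *ᵥ xr) (L.Fb.A *ᵥ xb) (L.Fd.A *ᵥ xd)
        (L.C.A *ᵥ xc + L.errorSignal N₁ (L.σr * (L.Fr.c ⬝ᵥ xr))
          (N₂ * L.σ₂ * (L.Fb.c ⬝ᵥ xb) + L.σd * (L.Fd.c ⬝ᵥ xd)) xc xp • L.C.b)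
        (L.P.A *ᵥ xp + L.plantInput N₁ (L.σr * (L.Fr.c ⬝ᵥ xr))
          (N₂ * L.σ₂ * (L.Fb.c ⬝ᵥ xb) + L.σd * (L.Fd.c ⬝ᵥ xd)) xc xp • L.P.b) := by
  ext i
  rcases i with i | i | i | i | i
  · simp [mulVec, dotProduct, Fintype.sum_sum_type, toBlocks, matA]
  · simp [mulVec, dotProduct, Fintype.sum_sum_type, toBlocks, matA]
  · simp [mulVec, dotProduct, Fintype.sum_sum_type, toBlocks, matA]
  · have e : ∀ j, (L.C.A i j + L.C.A i j * L.C.d * L.P.d * N₁ - L.C.b i * L.C.c j * L.P.d * N₁) /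
        L.den N₁ = L.C.A i j - (L.C.b i * L.P.d * N₁ / L.den N₁) * L.C.c j := fun j => by
      field_simp
      rw [den]; ring
    simp only [mulVec, dotProduct, Fintype.sum_sum_type, toBlocks, matA, Sum.elim_inl,
      Sum.elim_inr, Pi.add_apply, Pi.smul_apply, smul_eq_mul]
    rw [sum_mul_mul_eq _ L.Fr.c xr (L.C.b i * L.σr / L.den N₁) (fun j => by ring),
      sum_mul_mul_eq _ L.Fb.c xb (-(L.C.b i * L.P.d * N₂ * L.σ₂ / L.den N₁)) (fun j => by ring),
      sum_mul_mul_eq _ L.Fd.c xd (-(L.C.b i * L.P.d * L.σd / L.den N₁)) (fun j => by ring),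
      sum_sub_mul_eq _ (L.C.A i) L.C.c xc _ e,
      sum_mul_mul_eq _ L.P.c xp (-(L.C.b i / L.den N₁)) (fun j => by ring), errorSignal]
    simp only [dotProduct]
    ring
  · have e : ∀ j, (L.P.A i j + L.P.A i j * L.C.d * L.P.d * N₁ - L.P.b i * L.P.c j * L.C.d * N₁) /
        L.den N₁ = L.P.A i j - (L.P.b i * L.C.d * N₁ / L.den N₁) * L.P.c j := fun j => by
      field_simp
      rw [den]; ring
    simp only [mulVec, dotProduct, Fintype.sum_sum_type, toBlocks, matA, Sum.elim_inl,
      Sum.elim_inr, Pi.add_apply, Pi.smul_apply, smul_eq_mul]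
    rw [sum_mul_mul_eq _ L.Fr.c xr (L.P.b i * L.C.d * N₁ * L.σr / L.den N₁) (fun j => by ring),
      sum_mul_mul_eq _ L.Fb.c xb (L.P.b i * N₂ * L.σ₂ / L.den N₁) (fun j => by ring),
      sum_mul_mul_eq _ L.Fd.c xd (L.P.b i * L.σd / L.den N₁) (fun j => by ring),
      sum_mul_mul_eq _ L.C.c xc (L.P.b i * N₁ / L.den N₁) (fun j => by ring),
      sum_sub_mul_eq _ (L.P.A i) L.P.c xp _ e, plantInput]
    simp only [dotProduct]
    ring

theorem rowC₁_dotProduct_toBlocks (N₁ N₂ : ℝ) (xr : Fin L.nr → ℝ)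
    (xb : Fin L.nb → ℝ) (xd : Fin L.nd → ℝ) (xc : Fin L.nc → ℝ) (xp : Fin L.np → ℝ) :
    L.rowC₁ N₁ N₂ ⬝ᵥ L.toBlocks xr xb xd xc xp =
      L.controlSignal N₁ (L.σr * (L.Fr.c ⬝ᵥ xr))
          (N₂ * L.σ₂ * (L.Fb.c ⬝ᵥ xb) + L.σd * (L.Fd.c ⬝ᵥ xd)) xc xp := by
  simp only [dotProduct, Fintype.sum_sum_type, toBlocks, rowC₁, Sum.elim_inl, Sum.elim_inr]
  rw [sum_mul_mul_eq _ L.Fr.c xr (L.C.d * L.σr / L.den N₁) (fun j => by ring),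
    sum_mul_mul_eq _ L.Fb.c xb (-(L.C.d * L.P.d * N₂ * L.σ₂ / L.den N₁)) (fun j => by ring),
    sum_mul_mul_eq _ L.Fd.c xd (-(L.C.d * L.P.d * L.σd / L.den N₁)) (fun j => by ring),
    sum_mul_mul_eq _ L.C.c xc (1 / L.den N₁) (fun j => by ring),
    sum_mul_mul_eq _ L.P.c xp (-(L.C.d / L.den N₁)) (fun j => by ring), controlSignal]
  simp only [dotProduct]
  ring

/-- The injection of filter signals and of an additional reference `w₀` into the loop. -/
def injection (L : Loop) (N₁ : ℝ) (br : Fin L.nr → ℝ) (bb : Fin L.nb → ℝ) (bd : Fin L.nd → ℝ)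
    (w₀ : ℝ) : L.State → ℝ :=
  L.toBlocks br bb bd ((w₀ / L.den N₁) • L.C.b) ((L.C.d * N₁ * w₀ / L.den N₁) • L.P.b)

theorem eq_smul_inv_mulVec {n : ℕ} {X : Matrix (Fin n) (Fin n) ℝ} (hX : IsUnit X.det)
    {x b : Fin n → ℝ} {e : ℝ} (h : X *ᵥ x = e • b) : x = e • (X⁻¹ *ᵥ b) := by
  rw [← mulVec_smul, ← h, mulVec_mulVec, Matrix.nonsing_inv_mul _ hX, one_mulVec]

/-- The closed-loop response from reference and disturbance to the controller output. -/
theorem closedLoop_response {N₁ N₂ s : ℝ} (hden : L.den N₁ ≠ 0)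
    (hA : IsUnit (s • (1 : Matrix L.State L.State ℝ) - L.matA N₁ N₂).det)
    (hr : IsUnit (s • (1 : Matrix (Fin L.nr) (Fin L.nr) ℝ) - L.Fr.A).det)
    (hb : IsUnit (s • (1 : Matrix (Fin L.nb) (Fin L.nb) ℝ) - L.Fb.A).det)
    (hd : IsUnit (s • (1 : Matrix (Fin L.nd) (Fin L.nd) ℝ) - L.Fd.A).det)
    (hc : IsUnit (s • (1 : Matrix (Fin L.nc) (Fin L.nc) ℝ) - L.C.A).det)
    (hp : IsUnit (s • (1 : Matrix (Fin L.np) (Fin L.np) ℝ) - L.P.A).det)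
    (kr kb kd w₀ : ℝ) :
    (L.rowC₁ N₁ N₂ ⬝ᵥ ((s • (1 : Matrix L.State L.State ℝ) - L.matA N₁ N₂)⁻¹ *ᵥ
        L.injection N₁ (kr • L.Fr.b) (kb • L.Fb.b) (kd • L.Fd.b) w₀) + L.C.d * w₀ / L.den N₁) *
      (1 + N₁ * L.C.transfer s * L.P.transfer s) =
    L.C.transfer s * (L.σr * (kr * (L.Fr.c ⬝ᵥ L.Fr.resp s)) + w₀ - L.P.transfer s *
      (N₂ * L.σ₂ * (kb * (L.Fb.c ⬝ᵥ L.Fb.resp s)) + L.σd * (kd * (L.Fd.c ⬝ᵥ L.Fd.resp s)))) := by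
  set b₀ := L.injection N₁ (kr • L.Fr.b) (kb • L.Fb.b) (kd • L.Fd.b) w₀ with hb₀
  set x := (s • (1 : Matrix L.State L.State ℝ) - L.matA N₁ N₂)⁻¹ *ᵥ b₀ with hx
  have hsx : s • x = L.matA N₁ N₂ *ᵥ x + b₀ := by
    have : (s • (1 : Matrix L.State L.State ℝ) - L.matA N₁ N₂) *ᵥ x = b₀ := by
      rw [hx, mulVec_mulVec, Matrix.mul_nonsing_inv _ hA, one_mulVec]
    rw [← this, sub_mulVec, smul_mulVec, one_mulVec]; abel
  obtain ⟨xr, xb, xd, xc, xp, hxe⟩ := L.exists_toBlocks x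
  rw [hxe, matA_mulVec_toBlocks hden, hb₀, injection] at hsx
  rw [hxe, rowC₁_dotProduct_toBlocks]
  rw [smul_toBlocks, toBlocks_add] at hsx
  obtain ⟨er, eb, ed, ec, ep⟩ := toBlocks_inj hsx
  have hxr : xr = kr • L.Fr.resp s := eq_smul_inv_mulVec hr (by
    rw [sub_mulVec, smul_mulVec, one_mulVec, er, add_sub_cancel_left])
  have hxb : xb = kb • L.Fb.resp s := eq_smul_inv_mulVec hb (by
    rw [sub_mulVec, smul_mulVec, one_mulVec, eb, add_sub_cancel_left])
  have hxd : xd = kd • L.Fd.resp s := eq_smul_inv_mulVec hd (by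
    rw [sub_mulVec, smul_mulVec, one_mulVec, ed, add_sub_cancel_left])
  set w := L.σr * (L.Fr.c ⬝ᵥ xr) with hw
  set q := N₂ * L.σ₂ * (L.Fb.c ⬝ᵥ xb) + L.σd * (L.Fd.c ⬝ᵥ xd) with hq
  have hxc : xc = (L.errorSignal N₁ w q xc xp + w₀ / L.den N₁) • L.C.resp s :=
    eq_smul_inv_mulVec hc (by
      rw [sub_mulVec, smul_mulVec, one_mulVec, ec, add_smul]; abel)
  have hxp : xp = (L.plantInput N₁ w q xc xp + L.C.d * N₁ * w₀ / L.den N₁) • L.P.resp s :=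
    eq_smul_inv_mulVec hp (by
      rw [sub_mulVec, smul_mulVec, one_mulVec, ep, add_smul]; abel)
  have hyc := congrArg (L.C.c ⬝ᵥ ·) hxc
  have hyp := congrArg (L.P.c ⬝ᵥ ·) hxp
  simp only [dotProduct_smul, smul_eq_mul] at hyc hyp
  have hw' : w = L.σr * (kr * (L.Fr.c ⬝ᵥ L.Fr.resp s)) := by
    rw [hw, hxr, dotProduct_smul, smul_eq_mul]
  have hq' : q = N₂ * L.σ₂ * (kb * (L.Fb.c ⬝ᵥ L.Fb.resp s)) +
      L.σd * (kd * (L.Fd.c ⬝ᵥ L.Fd.resp s)) := by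
    rw [hq, hxb, hxd, dotProduct_smul, dotProduct_smul, smul_eq_mul, smul_eq_mul]
  rw [← hw', ← hq', SISO.transfer_eq, SISO.transfer_eq]
  clear_value w q
  set γ := L.C.c ⬝ᵥ L.C.resp s
  set π := L.P.c ⬝ᵥ L.P.resp s
  set e := L.errorSignal N₁ w q xc xp + w₀ / L.den N₁ with he
  set z := L.plantInput N₁ w q xc xp + L.C.d * N₁ * w₀ / L.den N₁ with hz
  -- The block diagram is recovered in the form `u = C(s) e`, `z = N₁ u + q`, `e = w + w₀ - P(s) z`.
  -- Eliminating `e` and `z` gives the identity.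
  have hu : L.controlSignal N₁ w q xc xp + L.C.d * w₀ / L.den N₁ = (γ + L.C.d) * e := by
    have e1 : L.controlSignal N₁ w q xc xp + L.C.d * w₀ / L.den N₁ =
        L.C.c ⬝ᵥ xc + L.C.d * e := by
      rw [he, controlSignal, errorSignal]
      field_simp
      rw [den]; ring
    rw [e1, hyc]; ring
  have hz' : z = N₁ * ((γ + L.C.d) * e) + q := by
    rw [← hu, hz, controlSignal, plantInput]
    field_simp
    rw [den]; ring
  have he' : e = w + w₀ - (π + L.P.d) * z := by
    have e1 : e = w + w₀ - (L.P.c ⬝ᵥ xp + L.P.d * z) := by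
      rw [he, hz, errorSignal, plantInput]
      field_simp
      rw [den]; ring
    rw [e1, hyp]; ring
  rw [hu]
  linear_combination (γ + L.C.d) * he' + (γ + L.C.d) * (-(π + L.P.d)) * hz'

end Loop

namespace Loop

/-! ### Consequences of closed-loop stability -/

variable {L : Loop}

theorem eventually_closedLoop_response {N₁ N₂ : ℝ} (hden : L.den N₁ ≠ 0) (kr kb kd w₀ : ℝ) :
    ∀ᶠ s in 𝓝[≠] (0 : ℝ),
    (L.rowC₁ N₁ N₂ ⬝ᵥ ((s • (1 : Matrix L.State L.State ℝ) - L.matA N₁ N₂)⁻¹ *ᵥ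
        L.injection N₁ (kr • L.Fr.b) (kb • L.Fb.b) (kd • L.Fd.b) w₀) + L.C.d * w₀ / L.den N₁) *
      (1 + N₁ * L.C.transfer s * L.P.transfer s) =
    L.C.transfer s * (L.σr * (kr * (L.Fr.c ⬝ᵥ L.Fr.resp s)) + w₀ - L.P.transfer s *
      (N₂ * L.σ₂ * (kb * (L.Fb.c ⬝ᵥ L.Fb.resp s)) + L.σd * (kd * (L.Fd.c ⬝ᵥ L.Fd.resp s)))) := by
  filter_upwards [eventually_isUnit_det_smul_one_sub (L.matA N₁ N₂) 0,
    eventually_isUnit_det_smul_one_sub L.Fr.A 0, eventually_isUnit_det_smul_one_sub L.Fb.A 0,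
    eventually_isUnit_det_smul_one_sub L.Fd.A 0, eventually_isUnit_det_smul_one_sub L.C.A 0,
    eventually_isUnit_det_smul_one_sub L.P.A 0] with s hA hr hb hd hc hp
  exact closedLoop_response hden hA hr hb hd hc hp kr kb kd w₀

/-- Stability keeps the response `H(s)` from an extra reference to `u₁` finite at `s = 0`. If the
factor vanished, the limit of `H(s) (1 + N₁ C(s) P(s)) = C(s)` would give `c = 0`. -/
theorem one_add_gain_mul_ne_zero {N₁ N₂ c p : ℝ} (hden : L.den N₁ ≠ 0)
    (hA : IsHurwitz (L.matA N₁ N₂)) (hC : L.C.IsDCGain c) (hP : L.P.IsDCGain p) (hc : c ≠ 0) :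
    1 + N₁ * c * p ≠ 0 := by
  intro h0
  have hC' : Tendsto L.C.transfer (𝓝[≠] 0) (𝓝 c) :=
    OnePoint.isOpenEmbedding_coe.isInducing.tendsto_nhds_iff.2 hC
  have hP' : Tendsto L.P.transfer (𝓝[≠] 0) (𝓝 p) :=
    OnePoint.isOpenEmbedding_coe.isInducing.tendsto_nhds_iff.2 hP
  have hresp := eventually_closedLoop_response (N₂ := N₂) hden 0 0 0 1
  have hu := hA.isUnit_det_smul_one_sub le_rfl
  have hcont := continuousAt_resolvent_mulVec hu
    (L.injection N₁ ((0 : ℝ) • L.Fr.b) ((0 : ℝ) • L.Fb.b) ((0 : ℝ) • L.Fd.b) 1)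
  have hcont' := ContinuousAt.comp (g := fun z => L.rowC₁ N₁ N₂ ⬝ᵥ z + L.C.d * 1 / L.den N₁)
    (by fun_prop) hcont
  have hlim := (hcont'.tendsto.mono_left (nhdsWithin_le_nhds (s := {0}ᶜ))).mul
    (((hC'.const_mul N₁).mul hP').const_add 1)
  rw [h0, mul_zero] at hlim
  refine hc (tendsto_nhds_unique hC' (hlim.congr' ?_))
  filter_upwards [hresp] with s hs
  refine hs.trans ?_
  simp

theorem gain_add_recip_ne_zero {N₁ N₂ : ℝ} {Cdc Pdc : OnePoint ℝ} (hden : L.den N₁ ≠ 0)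
    (hA : IsHurwitz (L.matA N₁ N₂)) (hC : L.C.IsDCGain Cdc) (hP : L.P.IsDCGain Pdc)
    (hC0 : Cdc ≠ ((0 : ℝ) : OnePoint ℝ)) (hP0 : Pdc ≠ ((0 : ℝ) : OnePoint ℝ))
    (hCi : Cdc ≠ OnePoint.infty) (hPi : Pdc ≠ OnePoint.infty) :
    N₁ + recip Cdc * recip Pdc ≠ 0 := by
  obtain ⟨c, rfl⟩ := OnePoint.ne_infty_iff_exists.1 hCi
  obtain ⟨p, rfl⟩ := OnePoint.ne_infty_iff_exists.1 hPi
  have hc : c ≠ 0 := fun h => hC0 (by rw [h])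
  have hp : p ≠ 0 := fun h => hP0 (by rw [h])
  have h := one_add_gain_mul_ne_zero hden hA hC hP hc
  change N₁ + c⁻¹ * p⁻¹ ≠ 0
  intro h0
  apply h
  field_simp at h0
  linarith

theorem matB_col_zero (N₁ N₂ : ℝ) (hFr : L.Fr.d = 0) :
    (L.matB N₁ N₂).col 0 =
      L.injection N₁ ((1 : ℝ) • L.Fr.b) ((0 : ℝ) • L.Fb.b) ((0 : ℝ) • L.Fd.b) 0 := by
  ext i
  rcases i with i | i | i | i | i <;> simp [matB, injection, toBlocks, hFr, Matrix.col]

theorem matB_col_one (N₁ N₂ : ℝ) (hFd : L.Fd.d = 0) :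
    (L.matB N₁ N₂).col 1 =
      L.injection N₁ ((0 : ℝ) • L.Fr.b) ((0 : ℝ) • L.Fb.b) ((1 : ℝ) • L.Fd.b) 0 := by
  ext i
  rcases i with i | i | i | i | i <;> simp [matB, injection, toBlocks, hFd, Matrix.col]

/-- The coordinate projection onto the states of the filter of the second actuator input. -/
def filterProj (L : Loop) : Matrix (Fin L.nb) L.State ℝ :=
  (1 : Matrix L.State L.State ℝ).submatrix (fun i => .inr (.inl i)) id

theorem filterProj_mulVec (x : L.State → ℝ) (i : Fin L.nb) :
    (L.filterProj *ᵥ x) i = x (.inr (.inl i)) := by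
  have : (L.filterProj *ᵥ x) i = ((1 : Matrix L.State L.State ℝ) *ᵥ x) (.inr (.inl i)) := rfl
  rw [this, one_mulVec]

/-- The coloring filter of `u₂` runs autonomously, without feedback from the loop. -/
theorem filterProj_mul_matA (N₁ N₂ : ℝ) :
    L.filterProj * L.matA N₁ N₂ = L.Fb.A * L.filterProj := by
  ext i j
  have h1 : (L.filterProj * L.matA N₁ N₂) i j = L.matA N₁ N₂ (.inr (.inl i)) j :=
    filterProj_mulVec (fun k => L.matA N₁ N₂ k j) i
  rw [h1]
  rcases j with j | j | j | j | j <;>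
    simp [matA, Matrix.mul_apply, filterProj, Matrix.one_apply]

theorem rowC₂_dotProduct (x : L.State → ℝ) :
    L.rowC₂ ⬝ᵥ x = L.σ₂ * (L.Fb.c ⬝ᵥ (L.filterProj *ᵥ x)) := by
  simp only [dotProduct, filterProj_mulVec, Fintype.sum_sum_type, rowC₂, zero_mul,
    Finset.sum_const_zero, zero_add, add_zero, Finset.mul_sum]
  exact Finset.sum_congr rfl fun i _ => by ring

theorem rowC₂_dotProduct_exp (N₁ N₂ t : ℝ) (x : L.State → ℝ) :
    L.rowC₂ ⬝ᵥ (NormedSpace.exp (t • L.matA N₁ N₂) *ᵥ x) =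
      L.σ₂ * (L.Fb.c ⬝ᵥ (NormedSpace.exp (t • L.Fb.A) *ᵥ (L.filterProj *ᵥ x))) := by
  rw [rowC₂_dotProduct, mulVec_mulVec, mul_exp_smul_of_intertwine (filterProj_mul_matA N₁ N₂),
    mulVec_mulVec]

theorem filterProj_mulVec_matB_col (N₁ N₂ : ℝ) (k : Fin 3) :
    L.filterProj *ᵥ (L.matB N₁ N₂).col k = (![0, 0, 1] k : ℝ) • L.Fb.b := by
  ext i
  rw [filterProj_mulVec]
  fin_cases k <;> simp [matB, Matrix.col]

theorem rowC₂_quadForm {N₁ N₂ : ℝ} {V : Matrix L.State L.State ℝ}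
    (hA : IsHurwitz (L.matA N₁ N₂)) (hV : L.IsStateCov N₁ N₂ V) (hFb : L.Fb.HasH2NormOne) :
    L.rowC₂ ⬝ᵥ (V *ᵥ L.rowC₂) = L.σ₂ ^ 2 := by
  have h := hA.tendsto_integral_energy hV L.rowC₂
  have e : ∀ t : ℝ, ∑ k, (L.rowC₂ ⬝ᵥ
      (NormedSpace.exp (t • L.matA N₁ N₂) *ᵥ (L.matB N₁ N₂).col k)) ^ 2 =
      L.σ₂ ^ 2 * L.Fb.impulse t ^ 2 := by
    intro t
    simp only [rowC₂_dotProduct_exp, filterProj_mulVec_matB_col, mulVec_smul, dotProduct_smul,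
      Fin.sum_univ_three, SISO.impulse]
    simp
    ring
  simp_rw [e, intervalIntegral.integral_const_mul] at h
  simpa using tendsto_nhds_unique h (hFb.tendsto_integral.const_mul (L.σ₂ ^ 2))

/-- The first actuator input is not a multiple of the second one. -/
theorem quadForm_pos {N₁ N₂ : ℝ} {V : Matrix L.State L.State ℝ} (hden : L.den N₁ ≠ 0)
    (hA : IsHurwitz (L.matA N₁ N₂)) (hV : L.IsStateCov N₁ N₂ V)
    (hFr : L.Fr.HasH2NormOne) (hFd : L.Fd.HasH2NormOne)
    (hσ : 0 < L.σr ∨ 0 < L.σd)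
    (hC : ∀ᶠ s in 𝓝[≠] (0 : ℝ), L.C.transfer s ≠ 0)
    (hP : ∀ᶠ s in 𝓝[≠] (0 : ℝ), L.P.transfer s ≠ 0) (y : ℝ) :
    0 < (L.rowC₁ N₁ N₂ + y • L.rowC₂) ⬝ᵥ (V *ᵥ (L.rowC₁ N₁ N₂ + y • L.rowC₂)) := by
  by_contra hcon
  -- The condition on `k` selects the noises `w_r` and `w_d`. They do not reach `u₂`, so the term
  -- with `y` drops out of the impulse response.
  have hzero : ∀ k : Fin 3, (![0, 0, 1] k : ℝ) = 0 → ∀ᶠ s in 𝓝[≠] (0 : ℝ), L.rowC₁ N₁ N₂ ⬝ᵥ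
      ((s • (1 : Matrix L.State L.State ℝ) - L.matA N₁ N₂)⁻¹ *ᵥ (L.matB N₁ N₂).col k) = 0 := by
    intro k hk
    filter_upwards [eventually_isUnit_det_smul_one_sub (L.matA N₁ N₂) 0] with s hs
    refine resolvent_eq_zero_of_exp_eq_zero (fun t ht => ?_) hs
    have := hA.impulse_eq_zero_of_quadForm_nonpos hV (not_lt.1 hcon) ht k
    rwa [add_dotProduct, smul_dotProduct, rowC₂_dotProduct_exp, filterProj_mulVec_matB_col, hk,
      zero_smul, mulVec_zero, dotProduct_zero, mul_zero, smul_zero, add_zero] at this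
  rcases hσ with hσ | hσ
  · refine hFr.frequently_ne_zero ?_
    filter_upwards [hzero 0 rfl, eventually_closedLoop_response (N₂ := N₂) hden 1 0 0 0, hC]
      with s h0 hs hCs
    rw [← matB_col_zero N₁ N₂ hFr.1, h0] at hs
    simpa [hCs, hσ.ne'] using hs
  · refine hFd.frequently_ne_zero ?_
    filter_upwards [hzero 1 rfl, eventually_closedLoop_response (N₂ := N₂) hden 0 0 1 0, hC, hP]
      with s h0 hs hCs hPs
    rw [← matB_col_one N₁ N₂ hFd.1, h0] at hs
    simpa [hCs, hPs, hσ.ne'] using hs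

theorem quadForm_add_smul {ι : Type} [Fintype ι] {V : Matrix ι ι ℝ} (hV : Vᵀ = V) (a b : ι → ℝ)
    (y : ℝ) : (a + y • b) ⬝ᵥ (V *ᵥ (a + y • b)) =
      a ⬝ᵥ (V *ᵥ a) + 2 * y * (a ⬝ᵥ (V *ᵥ b)) + y ^ 2 * (b ⬝ᵥ (V *ᵥ b)) := by
  have h : b ⬝ᵥ (V *ᵥ a) = a ⬝ᵥ (V *ᵥ b) := by
    rw [dotProduct_comm, ← vecMul_transpose, hV, ← dotProduct_mulVec]
  simp only [mulVec_add, mulVec_smul, add_dotProduct, dotProduct_add, smul_dotProduct,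
    dotProduct_smul, smul_eq_mul, h]
  ring

end Loop

/-! ### The saturation -/

/-- The threshold on `u₂` gives `α - u₂ ≤ 0 ≤ β + u₂`, so the two bounds are correctly ordered. -/
theorem sat_eq_clamp {α β u₂ : ℝ} (h : max (-β) α ≤ u₂) (u₁ : ℝ) :
    sat α β u₁ u₂ = max (α - u₂) (min u₁ (β + u₂)) := by
  have h1 := (le_max_left (-β) α).trans h
  have h2 := (le_max_right (-β) α).trans h
  rw [sat, if_pos h]
  split_ifs with h3 h4
  · rw [min_eq_right h3.le, max_eq_right (by linarith)]
  · rw [min_eq_left (not_lt.1 h3), max_eq_left h4.le]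
  · rw [min_eq_left (not_lt.1 h3), max_eq_right (not_lt.1 h4)]

theorem lipschitzWith_sat (α β u₂ : ℝ) : LipschitzWith 1 (fun u₁ => sat α β u₁ u₂) := by
  by_cases h : max (-β) α ≤ u₂
  · simp_rw [sat_eq_clamp h]
    exact (LipschitzWith.id.min_const _).const_max _
  · simp only [sat, if_neg h]
    exact (LipschitzWith.const _).weaken zero_le_one

theorem abs_sat_le (α β u₁ u₂ : ℝ) : |sat α β u₁ u₂| ≤ (|α| + |β|) + |u₂| := by
  have hα := abs_le.1 (le_refl |α|)
  have hβ := abs_le.1 (le_refl |β|)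
  have hu := abs_le.1 (le_refl |u₂|)
  unfold sat
  split_ifs with h h3 h4 <;> rw [abs_le] <;> constructor <;>
    linarith [abs_nonneg α, abs_nonneg β, abs_nonneg u₂]

theorem abs_satGrad₁_le (α β u₁ u₂ : ℝ) : |satGrad₁ α β u₁ u₂| ≤ 1 + |u₂| := by
  have := abs_nonneg u₂
  unfold satGrad₁
  split_ifs <;> simp <;> linarith

theorem abs_satGrad₂_le (α β u₁ u₂ : ℝ) : |satGrad₂ α β u₁ u₂| ≤ 1 + |u₂| := by
  have := abs_nonneg u₂
  unfold satGrad₂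
  split_ifs <;> simp <;> linarith

theorem measurable_sat (α β : ℝ) : Measurable (fun u : ℝ × ℝ => sat α β u.1 u.2) := by
  unfold sat
  refine Measurable.ite (measurableSet_le (by fun_prop) (by fun_prop)) ?_ (by fun_prop)
  refine Measurable.ite (measurableSet_lt (by fun_prop) (by fun_prop)) (by fun_prop) ?_
  exact Measurable.ite (measurableSet_lt (by fun_prop) (by fun_prop)) (by fun_prop) (by fun_prop)

theorem measurable_satGrad₁ (α β : ℝ) : Measurable (fun u : ℝ × ℝ => satGrad₁ α β u.1 u.2) := by
  unfold satGrad₁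
  refine Measurable.ite (measurableSet_le (by fun_prop) (by fun_prop)) ?_ (by fun_prop)
  refine Measurable.ite (measurableSet_lt (by fun_prop) (by fun_prop)) (by fun_prop) ?_
  exact Measurable.ite (measurableSet_lt (by fun_prop) (by fun_prop)) (by fun_prop) (by fun_prop)

theorem measurable_satGrad₂ (α β : ℝ) : Measurable (fun u : ℝ × ℝ => satGrad₂ α β u.1 u.2) := by
  unfold satGrad₂
  refine Measurable.ite (measurableSet_le (by fun_prop) (by fun_prop)) ?_ (by fun_prop)
  refine Measurable.ite (measurableSet_lt (by fun_prop) (by fun_prop)) (by fun_prop) ?_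
  exact Measurable.ite (measurableSet_lt (by fun_prop) (by fun_prop)) (by fun_prop) (by fun_prop)

/-- Away from the two switching lines, the position of `u₁` relative to them is locally constant. -/
theorem eventually_same_side {α β u₁ u₂ : ℝ} (h₁ : u₁ ≠ β + u₂) (h₂ : u₁ ≠ α - u₂) :
    ∀ᶠ x in 𝓝 u₁, (β + u₂ < x ↔ β + u₂ < u₁) ∧ (x < α - u₂ ↔ u₁ < α - u₂) := by
  refine Eventually.and ?_ ?_
  · rcases h₁.lt_or_gt with h | h
    · filter_upwards [gt_mem_nhds h] with x hx
      exact ⟨fun h' => absurd h' hx.not_gt, fun h' => absurd h' h.not_gt⟩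
    · filter_upwards [lt_mem_nhds h] with x hx
      exact ⟨fun _ => h, fun _ => hx⟩
  · rcases h₂.lt_or_gt with h | h
    · filter_upwards [gt_mem_nhds h] with x hx
      exact ⟨fun _ => h, fun _ => hx⟩
    · filter_upwards [lt_mem_nhds h] with x hx
      exact ⟨fun h' => absurd h' hx.not_gt, fun h' => absurd h' h.not_gt⟩

theorem continuousAt_satGrad₁ {α β u₁ u₂ : ℝ} (h₁ : u₁ ≠ β + u₂) (h₂ : u₁ ≠ α - u₂) :
    ContinuousAt (fun x => satGrad₁ α β x u₂) u₁ := by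
  have : (fun x => satGrad₁ α β x u₂) =ᶠ[𝓝 u₁] fun _ => satGrad₁ α β u₁ u₂ := by
    filter_upwards [eventually_same_side h₁ h₂] with x hx
    simp only [satGrad₁, hx.1, hx.2]
  exact continuousAt_const.congr this.symm

theorem continuousAt_satGrad₂ {α β u₁ u₂ : ℝ} (h₁ : u₁ ≠ β + u₂) (h₂ : u₁ ≠ α - u₂) :
    ContinuousAt (fun x => satGrad₂ α β x u₂) u₁ := by
  have : (fun x => satGrad₂ α β x u₂) =ᶠ[𝓝 u₁] fun _ => satGrad₂ α β u₁ u₂ := by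
    filter_upwards [eventually_same_side h₁ h₂] with x hx
    simp only [satGrad₂, hx.1, hx.2]
  exact continuousAt_const.congr this.symm

theorem hasDerivAt_sat {α β u₁ u₂ : ℝ} (h₁ : u₁ ≠ β + u₂) (h₂ : u₁ ≠ α - u₂) :
    HasDerivAt (fun x => sat α β x u₂) (satGrad₁ α β u₁ u₂) u₁ := by
  have : (fun x => sat α β x u₂) =ᶠ[𝓝 u₁] fun x => if max (-β) α ≤ u₂ then
      if β + u₂ < u₁ then β + u₂ else if u₁ < α - u₂ then α - u₂ else x else 0 := by
    filter_upwards [eventually_same_side h₁ h₂] with x hx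
    simp only [sat, hx.1, hx.2]
  refine HasDerivAt.congr_of_eventuallyEq ?_ this
  unfold satGrad₁
  split_ifs
  · exact hasDerivAt_const _ _
  · exact hasDerivAt_const _ _
  · exact hasDerivAt_id _
  · exact hasDerivAt_const _ _

/-! ### Gaussian averages -/

/-- A pair of independent standard normal variables. -/
abbrev stdPair : Measure (ℝ × ℝ) := (gaussianReal 0 1).prod (gaussianReal 0 1)

theorem integral_biGaussian {h : ℝ → ℝ → ℝ} (hm : Measurable (fun u : ℝ × ℝ => h u.1 u.2))
    (μ₁ μ₂ σ₁ σ₂ ρ : ℝ) : ∫ u, h u.1 u.2 ∂(biGaussian μ₁ μ₂ σ₁ σ₂ ρ) =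
      ∫ z, h (μ₁ + σ₁ * (√(1 - ρ ^ 2) * z.1 + ρ * z.2)) (μ₂ + σ₂ * z.2) ∂stdPair := by
  rw [biGaussian, integral_map (by fun_prop) hm.aestronglyMeasurable]

/-- Each horizontal section of the exceptional set has at most one point, and the Gaussian law has
no atoms. -/
theorem ae_mul_fst_ne {κ : ℝ} (hκ : κ ≠ 0) {g : ℝ → ℝ} (hg : Measurable g) :
    ∀ᵐ z ∂stdPair, κ * z.1 ≠ g z.2 := by
  rw [ae_iff]
  simp only [ne_eq, not_not]
  have hs : MeasurableSet {z : ℝ × ℝ | κ * z.1 = g z.2} :=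
    measurableSet_eq_fun (by fun_prop) (by fun_prop)
  rw [Measure.prod_apply_symm hs]
  have h0 : ∀ y, gaussianReal 0 1 ((fun x => (x, y)) ⁻¹' {z : ℝ × ℝ | κ * z.1 = g z.2}) = 0 := by
    intro y
    have := nullSingletonClass_gaussianReal (μ := 0) (v := 1) one_ne_zero
    refine Set.Subsingleton.measure_zero (fun a ha b hb => ?_) _
    exact mul_left_cancel₀ hκ ((ha : κ * a = g y).trans (hb : κ * b = g y).symm)
  rw [lintegral_congr h0, lintegral_zero]

theorem ae_off_switching_lines (α β μ₁ μ₂ σ₂ : ℝ) {σ₁ ρ : ℝ} (hσ : 0 < σ₁) (hρ : |ρ| < 1) :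
    ∀ᵐ z ∂stdPair,
      μ₁ + σ₁ * (√(1 - ρ ^ 2) * z.1 + ρ * z.2) ≠ β + (μ₂ + σ₂ * z.2) ∧
      μ₁ + σ₁ * (√(1 - ρ ^ 2) * z.1 + ρ * z.2) ≠ α - (μ₂ + σ₂ * z.2) := by
  have hκ : σ₁ * √(1 - ρ ^ 2) ≠ 0 := by
    have : ρ ^ 2 < 1 := (sq_lt_one_iff_abs_lt_one ρ).2 hρ
    have : 0 < √(1 - ρ ^ 2) := Real.sqrt_pos.2 (by linarith)
    positivity
  filter_upwards [ae_mul_fst_ne hκ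
      (g := fun y => β + (μ₂ + σ₂ * y) - μ₁ - σ₁ * (ρ * y)) (by fun_prop),
    ae_mul_fst_ne hκ (g := fun y => α - (μ₂ + σ₂ * y) - μ₁ - σ₁ * (ρ * y)) (by fun_prop)]
    with z h1 h2
  exact ⟨fun h => h1 (by linarith), fun h => h2 (by linarith)⟩

theorem integrable_add_abs (c μ₂ σ₂ : ℝ) :
    Integrable (fun z : ℝ × ℝ => c + |μ₂ + σ₂ * z.2|) stdPair := by
  have h : Integrable (fun x : ℝ => x) (gaussianReal 0 1) :=
    (memLp_id_gaussianReal 1).integrable le_rfl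
  have h' : Integrable (fun z : ℝ × ℝ => z.2) stdPair := h.comp_snd _
  exact (integrable_const c).add (((integrable_const μ₂).add (h'.const_mul σ₂)).abs)

/-- The parameters are moved into the integrand over a fixed measure, where dominated convergence
applies. Only continuity in `u₁` off the switching lines is needed: `u₂` does not depend on the
parameters, so the jump at its threshold is harmless. -/
theorem continuousAt_integral_biGaussian {α β c : ℝ} {h : ℝ → ℝ → ℝ}
    (hm : Measurable (fun u : ℝ × ℝ => h u.1 u.2)) (hb : ∀ u₁ u₂, |h u₁ u₂| ≤ c + |u₂|)
    (hc : ∀ u₁ u₂, u₁ ≠ β + u₂ → u₁ ≠ α - u₂ → ContinuousAt (fun x => h x u₂) u₁)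
    (μ₁ μ₂ σ₂ : ℝ) {σ₁ ρ : ℝ} (hσ : 0 < σ₁) (hρ : |ρ| < 1) :
    ContinuousAt (fun θ : ℝ × ℝ × ℝ => ∫ u, h u.1 u.2 ∂(biGaussian θ.1 μ₂ θ.2.1 σ₂ θ.2.2))
      (μ₁, σ₁, ρ) := by
  simp_rw [integral_biGaussian hm]
  refine continuousAt_of_dominated (bound := fun z => c + |μ₂ + σ₂ * z.2|) ?_ ?_
    (integrable_add_abs c μ₂ σ₂) ?_
  · refine Eventually.of_forall fun θ => ?_
    exact (hm.comp (f := fun z : ℝ × ℝ => (θ.1 + θ.2.1 * (√(1 - θ.2.2 ^ 2) * z.1 + θ.2.2 * z.2),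
      μ₂ + σ₂ * z.2)) (by fun_prop)).aestronglyMeasurable
  · exact Eventually.of_forall fun θ => Eventually.of_forall fun z => hb _ _
  · filter_upwards [ae_off_switching_lines α β μ₁ μ₂ σ₂ hσ hρ] with z hz
    refine ContinuousAt.comp (g := fun x => h x (μ₂ + σ₂ * z.2))
      (f := fun θ : ℝ × ℝ × ℝ => θ.1 + θ.2.1 * (√(1 - θ.2.2 ^ 2) * z.1 + θ.2.2 * z.2))
      (hc _ _ hz.1 hz.2) ?_
    fun_prop

namespace Loop

variable (L : Loop)

theorem continuousAt_FN₁ (μ₁ : ℝ) {σ₁ ρ : ℝ} (hσ : 0 < σ₁) (hρ : |ρ| < 1) :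
    ContinuousAt (fun θ : ℝ × ℝ × ℝ => L.FN₁ θ.1 θ.2.1 θ.2.2) (μ₁, σ₁, ρ) :=
  continuousAt_integral_biGaussian (measurable_satGrad₁ L.α L.β) (abs_satGrad₁_le L.α L.β)
    (fun _ _ => continuousAt_satGrad₁) μ₁ L.μ₂ L.σ₂ hσ hρ

theorem continuousAt_FN₂ (μ₁ : ℝ) {σ₁ ρ : ℝ} (hσ : 0 < σ₁) (hρ : |ρ| < 1) :
    ContinuousAt (fun θ : ℝ × ℝ × ℝ => L.FN₂ θ.1 θ.2.1 θ.2.2) (μ₁, σ₁, ρ) :=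
  continuousAt_integral_biGaussian (measurable_satGrad₂ L.α L.β) (abs_satGrad₂_le L.α L.β)
    (fun _ _ => continuousAt_satGrad₂) μ₁ L.μ₂ L.σ₂ hσ hρ

theorem continuousAt_FM (μ₁ : ℝ) {σ₁ ρ : ℝ} (hσ : 0 < σ₁) (hρ : |ρ| < 1) :
    ContinuousAt (fun θ : ℝ × ℝ × ℝ => L.FM θ.1 θ.2.1 θ.2.2) (μ₁, σ₁, ρ) :=
  continuousAt_integral_biGaussian (α := L.α) (β := L.β) (measurable_sat L.α L.β)
    (abs_sat_le L.α L.β) (fun _ u₂ _ _ => (lipschitzWith_sat L.α L.β u₂).continuous.continuousAt)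
    μ₁ L.μ₂ L.σ₂ hσ hρ

/-- Changing the mean translates `u₁`; the saturation is 1-Lipschitz in `u₁` and differentiable off
a null set, so the derivative passes under the integral. -/
theorem hasDerivAt_FM (μ₁ : ℝ) {σ₁ ρ : ℝ} (hσ : 0 < σ₁) (hρ : |ρ| < 1) :
    HasDerivAt (fun x => L.FM x σ₁ ρ) (L.FN₁ μ₁ σ₁ ρ) μ₁ := by
  simp_rw [FM, FN₁, integral_biGaussian (measurable_sat L.α L.β),
    integral_biGaussian (measurable_satGrad₁ L.α L.β)]
  have hmeas : ∀ x : ℝ, Measurable (fun z : ℝ × ℝ =>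
      (x + σ₁ * (√(1 - ρ ^ 2) * z.1 + ρ * z.2), L.μ₂ + L.σ₂ * z.2)) := fun x => by fun_prop
  refine (hasDerivAt_integral_of_dominated_loc_of_lip (bound := fun _ => 1) univ_mem ?_ ?_ ?_ ?_
    (integrable_const 1) ?_).2
  · exact Eventually.of_forall fun x =>
      ((measurable_sat L.α L.β).comp (hmeas x)).aestronglyMeasurable
  · refine (integrable_add_abs (|L.α| + |L.β|) L.μ₂ L.σ₂).mono'
      ((measurable_sat L.α L.β).comp (hmeas μ₁)).aestronglyMeasurable ?_
    exact Eventually.of_forall fun z => abs_sat_le _ _ _ _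
  · exact ((measurable_satGrad₁ L.α L.β).comp (hmeas μ₁)).aestronglyMeasurable
  · refine Eventually.of_forall fun z => LipschitzWith.lipschitzOnWith ?_
    have := (lipschitzWith_sat L.α L.β (L.μ₂ + L.σ₂ * z.2)).comp
      (LipschitzWith.id.add (LipschitzWith.const (σ₁ * (√(1 - ρ ^ 2) * z.1 + ρ * z.2))))
    simpa [Function.comp_def] using this
  · filter_upwards [ae_off_switching_lines L.α L.β μ₁ L.μ₂ L.σ₂ hσ hρ] with z hz
    exact (hasDerivAt_sat hz.1 hz.2).comp_add_const μ₁ _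

end Loop

/-! ### Expanding maps of the line -/

theorem mul_abs_sub_le_of_le_abs_deriv {F F' : ℝ → ℝ} {δ : ℝ} (hF : ∀ x, HasDerivAt F (F' x) x)
    (hF' : ∀ x, δ ≤ |F' x|) (x y : ℝ) : δ * |x - y| ≤ |F x - F y| := by
  wlog hxy : x < y generalizing x y
  · rcases (not_lt.1 hxy).eq_or_lt with h | h
    · simp [h]
    · rw [abs_sub_comm x, abs_sub_comm (F x)]
      exact this y x h
  obtain ⟨z, _, hz⟩ := exists_hasDerivAt_eq_slope F F' hxy
    (fun x _ => (hF x).continuousAt.continuousWithinAt) (fun x _ => hF x)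
  have h := hF' z
  rw [hz, abs_div, le_div_iff₀ (abs_pos.2 (sub_ne_zero.2 hxy.ne'))] at h
  rwa [abs_sub_comm x, abs_sub_comm (F x)]

/-- Expansion gives injectivity, hence strict monotonicity, and at least linear growth in both
directions. -/
theorem surjective_of_mul_abs_sub_le {F : ℝ → ℝ} {δ : ℝ} (hδ : 0 < δ) (hc : Continuous F)
    (hF : ∀ x y, δ * |x - y| ≤ |F x - F y|) : Function.Surjective F := by
  have hinj : Function.Injective F := fun x y hxy => by
    have := hF x y
    rw [hxy, sub_self, abs_zero] at this
    have h0 := abs_nonneg (x - y)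
    exact sub_eq_zero.1 (abs_eq_zero.1 (le_antisymm (by nlinarith) h0))
  wlog hm : StrictMono F generalizing F
  · have hanti := (hc.strictMono_of_inj hinj).resolve_left hm
    have := this (F := fun x => -F x) hc.neg (fun x y => by
      rw [← neg_sub', abs_neg]; exact hF x y) (neg_injective.comp hinj) hanti.neg
    intro y
    obtain ⟨x, hx⟩ := this (-y)
    exact ⟨x, neg_injective hx⟩
  refine hc.surjective ?_ ?_
  · refine tendsto_atTop_mono' _ ?_ (tendsto_atTop_add_const_left _ (F 0)
      (tendsto_id.const_mul_atTop hδ))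
    filter_upwards [eventually_ge_atTop 0] with x hx
    have := hF x 0
    rw [sub_zero, abs_of_nonneg hx, abs_of_nonneg (sub_nonneg.2 (hm.monotone hx))] at this
    simp only [id]; linarith
  · refine tendsto_atBot_mono' _ ?_ (tendsto_atBot_add_const_left _ (F 0)
      (tendsto_id.const_mul_atBot hδ))
    filter_upwards [eventually_le_atBot 0] with x hx
    have := hF x 0
    rw [sub_zero, abs_of_nonpos hx, abs_of_nonpos (sub_nonpos.2 (hm.monotone hx))] at this
    simp only [id]; linarith

/-! ### Statistics of the quasilinearized loop -/

namespace Loop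

variable (L : Loop)

theorem continuousOn_matA {S : Set (ℝ × ℝ)} (hS : ∀ p ∈ S, L.den p.1 ≠ 0) :
    ContinuousOn (fun p : ℝ × ℝ => L.matA p.1 p.2) S := by
  have hd : ContinuousOn (fun p : ℝ × ℝ => L.den p.1) S := by unfold den; fun_prop
  refine continuousOn_pi.2 fun i => continuousOn_pi.2 fun j => ?_
  rcases i with i | i | i | i | i <;> rcases j with j | j | j | j | j <;> simp only [matA] <;>
    first
    | exact continuousOn_const
    | exact ContinuousOn.div (by fun_prop) hd hS
    | exact (ContinuousOn.div (by fun_prop) hd hS).neg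

theorem continuousOn_matB {S : Set (ℝ × ℝ)} (hS : ∀ p ∈ S, L.den p.1 ≠ 0) :
    ContinuousOn (fun p : ℝ × ℝ => L.matB p.1 p.2) S := by
  have hd : ContinuousOn (fun p : ℝ × ℝ => L.den p.1) S := by unfold den; fun_prop
  refine continuousOn_pi.2 fun i => continuousOn_pi.2 fun k => ?_
  rcases i with i | i | i | i | i <;> fin_cases k <;> simp [matB] <;>
    first
    | exact continuousOn_const
    | exact ContinuousOn.div (by fun_prop) hd hS
    | exact (ContinuousOn.div (by fun_prop) hd hS).neg

theorem continuousOn_rowC₁ {S : Set (ℝ × ℝ)} (hS : ∀ p ∈ S, L.den p.1 ≠ 0) :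
    ContinuousOn (fun p : ℝ × ℝ => L.rowC₁ p.1 p.2) S := by
  have hd : ContinuousOn (fun p : ℝ × ℝ => L.den p.1) S := by unfold den; fun_prop
  refine continuousOn_pi.2 fun i => ?_
  rcases i with i | i | i | i | i <;> simp only [rowC₁] <;>
    first
    | exact ContinuousOn.div (by fun_prop) hd hS
    | exact (ContinuousOn.div (by fun_prop) hd hS).neg

/-- On a set of gains for which the loop is stable, the standard deviation and the correlation of
the first actuator input are continuous functions of the gains. -/
theorem exists_continuousOn_inputStat {S : Set (ℝ × ℝ)} (hden : ∀ p ∈ S, L.den p.1 ≠ 0)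
    (hA : ∀ p ∈ S, IsHurwitz (L.matA p.1 p.2)) (hFr : L.Fr.HasH2NormOne)
    (hFb : L.Fb.HasH2NormOne) (hFd : L.Fd.HasH2NormOne) (hσ : 0 < L.σr ∨ 0 < L.σd)
    (hσ₂ : 0 < L.σ₂) (hC : ∀ᶠ s in 𝓝[≠] (0 : ℝ), L.C.transfer s ≠ 0)
    (hP : ∀ᶠ s in 𝓝[≠] (0 : ℝ), L.P.transfer s ≠ 0) :
    ∃ σ ρ : ℝ × ℝ → ℝ, ContinuousOn σ S ∧ ContinuousOn ρ S ∧
      ∀ p ∈ S, 0 < σ p ∧ |ρ p| < 1 ∧ L.IsInputStat p.1 p.2 (σ p) (ρ p) := by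
  have hex : ∀ p : ℝ × ℝ, ∃ V, p ∈ S → L.IsStateCov p.1 p.2 V := by
    intro p
    by_cases hp : p ∈ S
    · obtain ⟨V, hV⟩ := (hA p hp).exists_lyapunov (L.matB p.1 p.2 * (L.matB p.1 p.2)ᵀ)
      exact ⟨V, fun _ => hV⟩
    · exact ⟨0, fun h => absurd h hp⟩
  choose V hV using hex
  have hBc := L.continuousOn_matB hden
  have hC₁c := L.continuousOn_rowC₁ hden
  have hBB : Continuous (fun X : Matrix L.State (Fin 3) ℝ => X * Xᵀ) := by fun_prop
  have hVc : ContinuousOn V S := continuousOn_lyapunov_solution (L.continuousOn_matA hden)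
    (hBB.comp_continuousOn hBc) hA hV
  have hquad : Continuous (fun z : (L.State → ℝ) × Matrix L.State L.State ℝ × (L.State → ℝ) =>
      z.1 ⬝ᵥ (z.2.1 *ᵥ z.2.2)) := by fun_prop
  set a : ℝ × ℝ → ℝ := fun p => L.rowC₁ p.1 p.2 ⬝ᵥ (V p *ᵥ L.rowC₁ p.1 p.2)
  set b : ℝ × ℝ → ℝ := fun p => L.rowC₁ p.1 p.2 ⬝ᵥ (V p *ᵥ L.rowC₂)
  have hac : ContinuousOn a S := hquad.comp_continuousOn (hC₁c.prodMk (hVc.prodMk hC₁c))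
  have hbc : ContinuousOn b S := hquad.comp_continuousOn
    (hC₁c.prodMk (hVc.prodMk continuousOn_const))
  have hgram : ∀ p ∈ S, b p ^ 2 < a p * L.σ₂ ^ 2 := by
    intro p hp
    -- This `y` minimizes the variance of `u₁ + y u₂`; positivity there is the strict Cauchy–Schwarz
    -- inequality, that is `|ρ| < 1`.
    have h := quadForm_pos (hden p hp) (hA p hp) (hV p hp) hFr hFd hσ hC hP (-(b p) / L.σ₂ ^ 2)
    rw [quadForm_add_smul ((hA p hp).isSymm_of_lyapunov (hV p hp)),
      rowC₂_quadForm (hA p hp) (hV p hp) hFb] at h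
    change 0 < a p + 2 * (-(b p) / L.σ₂ ^ 2) * b p + (-(b p) / L.σ₂ ^ 2) ^ 2 * L.σ₂ ^ 2 at h
    have e : a p + 2 * (-(b p) / L.σ₂ ^ 2) * b p + (-(b p) / L.σ₂ ^ 2) ^ 2 * L.σ₂ ^ 2 =
        (a p * L.σ₂ ^ 2 - b p ^ 2) / L.σ₂ ^ 2 := by
      field_simp; ring
    rw [e, div_pos_iff_of_pos_right (by positivity)] at h
    linarith
  have hapos : ∀ p ∈ S, 0 < a p := fun p hp => by
    have := (sq_nonneg (b p)).trans_lt (hgram p hp)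
    exact pos_of_mul_pos_left this (by positivity)
  refine ⟨fun p => √(a p), fun p => b p / (√(a p) * L.σ₂), hac.sqrt,
    hbc.div (hac.sqrt.mul continuousOn_const) fun p hp =>
      (mul_pos (Real.sqrt_pos.2 (hapos p hp)) hσ₂).ne', fun p hp => ?_⟩
  have hs := Real.sqrt_pos.2 (hapos p hp)
  refine ⟨hs, ?_, V p, hV p hp, hs, Real.sq_sqrt (hapos p hp).le, rfl⟩
  rw [← sq_lt_one_iff_abs_lt_one, div_pow, mul_pow, Real.sq_sqrt (hapos p hp).le,
    div_lt_one (mul_pos (hapos p hp) (by positivity))]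
  exact hgram p hp

/-- The mean equation determines the mean of the first actuator input as a continuous function
of the gains. -/
theorem exists_continuousOn_mean {S : Set (ℝ × ℝ)} {σ ρ : ℝ × ℝ → ℝ} (hσc : ContinuousOn σ S)
    (hρc : ContinuousOn ρ S) (hσ : ∀ p ∈ S, 0 < σ p) (hρ : ∀ p ∈ S, |ρ p| < 1) {K δ : ℝ}
    (hδ : 0 < δ) (hK : ∀ μ₁ σ₁ ρ : ℝ, 0 < σ₁ → |ρ| < 1 → δ ≤ |L.FN₁ μ₁ σ₁ ρ + K|) (c : ℝ) :
    ∃ μ : ℝ × ℝ → ℝ, ContinuousOn μ S ∧ ∀ p ∈ S, L.FM (μ p) (σ p) (ρ p) + K * μ p = c := by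
  have hexp : ∀ p ∈ S, ∀ x y, δ * |x - y| ≤
      |(L.FM x (σ p) (ρ p) + K * x) - (L.FM y (σ p) (ρ p) + K * y)| := fun p hp =>
    mul_abs_sub_le_of_le_abs_deriv (F := fun x => L.FM x (σ p) (ρ p) + K * x)
      (fun x => ((L.hasDerivAt_FM x (hσ p hp) (hρ p hp)).add
        ((hasDerivAt_id x).const_mul K)).congr_deriv (by rw [mul_one]))
      (fun x => hK x _ _ (hσ p hp) (hρ p hp))
  have hex : ∀ p : ℝ × ℝ, ∃ x, p ∈ S → L.FM x (σ p) (ρ p) + K * x = c := by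
    intro p
    by_cases hp : p ∈ S
    · have hc : Continuous fun x => L.FM x (σ p) (ρ p) + K * x :=
        (continuous_iff_continuousAt.2 fun x =>
          (L.hasDerivAt_FM x (hσ p hp) (hρ p hp)).continuousAt).add (by fun_prop)
      obtain ⟨x, hx⟩ := surjective_of_mul_abs_sub_le hδ hc (hexp p hp) c
      exact ⟨x, fun _ => hx⟩
    · exact ⟨0, fun h => absurd h hp⟩
  choose μ hμ using hex
  refine ⟨μ, fun p₀ hp₀ => ?_, hμ⟩
  have hFM : ContinuousWithinAt (fun p => L.FM (μ p₀) (σ p) (ρ p)) S p₀ :=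
    (L.continuousAt_FM (μ p₀) (hσ p₀ hp₀) (hρ p₀ hp₀)).comp_continuousWithinAt
      (f := fun p => (μ p₀, σ p, ρ p))
      (continuousWithinAt_const.prodMk ((hσc p₀ hp₀).prodMk (hρc p₀ hp₀)))
  rw [ContinuousWithinAt, tendsto_iff_dist_tendsto_zero] at hFM ⊢
  have hlim := hFM.const_mul δ⁻¹
  rw [mul_zero] at hlim
  refine squeeze_zero' (Eventually.of_forall fun _ => dist_nonneg) ?_ hlim
  filter_upwards [self_mem_nhdsWithin] with p hp
  have h := hexp p hp (μ p₀) (μ p)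
  -- Both roots solve the equation with the same `c`. Expansion at `p` thus bounds the distance of
  -- the roots by the change of `F_M` at the fixed mean `μ p₀`.
  have e : (L.FM (μ p₀) (σ p) (ρ p) + K * μ p₀) - (L.FM (μ p) (σ p) (ρ p) + K * μ p) =
      L.FM (μ p₀) (σ p) (ρ p) - L.FM (μ p₀) (σ p₀) (ρ p₀) := by
    rw [hμ p hp, ← hμ p₀ hp₀]; ring
  rw [e] at h
  rw [dist_comm, Real.dist_eq, Real.dist_eq, le_inv_mul_iff₀ hδ]
  exact h

/-- The denominator `N₁ + 1 / (C_dc P_dc)` of the mean equation is bounded away from zero. -/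
theorem exists_le_abs_gain_add_recip {Cdc Pdc : OnePoint ℝ}
    (hC : L.C.IsDCGain Cdc) (hP : L.P.IsDCGain Pdc)
    (hC0 : Cdc ≠ ((0 : ℝ) : OnePoint ℝ)) (hP0 : Pdc ≠ ((0 : ℝ) : OnePoint ℝ))
    (hstab : ∀ N₁ ∈ closure (rangeOf L.FN₁), ∃ N₂, L.den N₁ ≠ 0 ∧ IsHurwitz (L.matA N₁ N₂))
    (hcomp : IsCompact (closure (rangeOf L.FN₁)))
    (hderiv : Cdc = OnePoint.infty ∨ Pdc = OnePoint.infty →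
      ∃ d : ℝ, 0 < d ∧ ∀ μ₁ σ₁ ρ : ℝ, 0 < σ₁ → |ρ| < 1 →
        d ≤ |deriv (fun x : ℝ => L.FM x σ₁ ρ) μ₁|) :
    ∃ δ : ℝ, 0 < δ ∧ ∀ N₁ ∈ closure (rangeOf L.FN₁), δ ≤ |N₁ + recip Cdc * recip Pdc| := by
  by_cases hinf : Cdc = OnePoint.infty ∨ Pdc = OnePoint.infty
  · obtain ⟨d, hd, hbound⟩ := hderiv hinf
    have hK : recip Cdc * recip Pdc = 0 := by
      rcases hinf with h | h <;> simp [h, recip]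
    refine ⟨d, hd, fun N₁ hN₁ => ?_⟩
    rw [hK, add_zero]
    -- The derivative bound is a bound on the values of `F_{N₁}`, and being a closed condition it
    -- extends to the closure of the range.
    have hcl : IsClosed {x : ℝ | d ≤ |x|} := isClosed_le continuous_const continuous_abs
    refine closure_minimal ?_ hcl hN₁
    rintro _ ⟨μ₁, σ₁, ρ, hσ, hρ, rfl⟩
    have := hbound μ₁ σ₁ ρ hσ hρ
    rwa [(L.hasDerivAt_FM μ₁ hσ hρ).deriv] at this
  · push Not at hinf
    have hne : (closure (rangeOf L.FN₁)).Nonempty :=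
      Set.Nonempty.closure ⟨_, 0, 1, 0, one_pos, by simp, rfl⟩
    obtain ⟨N, hN, hmin⟩ := hcomp.exists_isMinOn hne
      (f := fun x => |x + recip Cdc * recip Pdc|) (by fun_prop)
    obtain ⟨N₂, hden, hA⟩ := hstab N hN
    exact ⟨_, abs_pos.2 (gain_add_recip_ne_zero hden hA hC hP hC0 hP0 hinf.1 hinf.2),
      fun x hx => hmin hx⟩

end Loop

theorem exists_closure_rangeOf_eq_Icc (F : ℝ → ℝ → ℝ → ℝ) (hc : IsCompact (closure (rangeOf F)))
    (hconv : Convex ℝ (closure (rangeOf F))) :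
    ∃ a b, a ≤ b ∧ closure (rangeOf F) = Set.Icc a b := by
  have hne : (closure (rangeOf F)).Nonempty :=
    Set.Nonempty.closure ⟨_, 0, 1, 0, one_pos, by simp, rfl⟩
  have h := eq_Icc_of_connected_compact ⟨hne, hconv.isPreconnected⟩ hc
  exact ⟨_, _, Set.nonempty_Icc.1 (h ▸ hne), h⟩

end QLC

end

/-! ### The fixed point of the gain map -/

theorem theorem3 (L : QLC.Loop) (Cdc Pdc : OnePoint ℝ)
    -- standing assumptions on the loop
    (hFr : L.Fr.HasH2NormOne) (hFb : L.Fb.HasH2NormOne) (hFd : L.Fd.HasH2NormOne)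
    (hσr : 0 ≤ L.σr) (hσd : 0 ≤ L.σd) (hσrd : 0 < L.σr ∨ 0 < L.σd) (hσ₂ : 0 < L.σ₂)
    (hC : L.C.IsDCGain Cdc) (hP : L.P.IsDCGain Pdc)
    (hC0 : Cdc ≠ ((0 : ℝ) : OnePoint ℝ)) (hP0 : Pdc ≠ ((0 : ℝ) : OnePoint ℝ))
    -- 1. the closed loop is well posed and its state matrix is Hurwitz
    (h1 : ∀ N₁ ∈ closure (QLC.rangeOf L.FN₁), ∀ N₂ ∈ closure (QLC.rangeOf L.FN₂),
      L.den N₁ ≠ 0 ∧ QLC.IsHurwitz (L.matA N₁ N₂))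
    -- 2. the closures of the ranges are compact and convex
    (h2N₁ : IsCompact (closure (QLC.rangeOf L.FN₁)) ∧ Convex ℝ (closure (QLC.rangeOf L.FN₁)))
    (h2N₂ : IsCompact (closure (QLC.rangeOf L.FN₂)) ∧ Convex ℝ (closure (QLC.rangeOf L.FN₂)))
    (h2M : IsCompact (closure (QLC.rangeOf L.FM)) ∧ Convex ℝ (closure (QLC.rangeOf L.FM)))
    -- 3. range conditions for infinite DC gains
    (h3C : Cdc = OnePoint.infty → QLC.recip Pdc * L.μr - L.μd ∈ QLC.rangeOf L.FM)
    (h3P : Pdc = OnePoint.infty → Cdc ≠ OnePoint.infty → -L.μd ∈ QLC.rangeOf L.FM)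
    -- 4. derivative bound for infinite DC gains
    (h4 : Cdc = OnePoint.infty ∨ Pdc = OnePoint.infty →
      ∃ d : ℝ, 0 < d ∧ ∀ μ₁ σ₁ ρ : ℝ, 0 < σ₁ → |ρ| < 1 →
        d ≤ |deriv (fun x : ℝ => L.FM x σ₁ ρ) μ₁|) :
    ∃ N₁ ∈ closure (QLC.rangeOf L.FN₁), ∃ N₂ ∈ closure (QLC.rangeOf L.FN₂),
      ∃ M ∈ closure (QLC.rangeOf L.FM), ∃ μ₁ σ₁ ρ : ℝ,
        L.IsInputMean Cdc Pdc N₁ N₂ M μ₁ ∧ L.IsInputStat N₁ N₂ σ₁ ρ ∧ |ρ| < 1 ∧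
        N₁ = L.FN₁ μ₁ σ₁ ρ ∧ N₂ = L.FN₂ μ₁ σ₁ ρ ∧ M = L.FM μ₁ σ₁ ρ ∧
        QLC.recip Pdc * L.μr - QLC.recip Cdc * QLC.recip Pdc * μ₁ - L.μd = L.FM μ₁ σ₁ ρ := by
  set S₁ := closure (QLC.rangeOf L.FN₁) with hS₁
  set S₂ := closure (QLC.rangeOf L.FN₂) with hS₂
  set K := QLC.recip Cdc * QLC.recip Pdc
  obtain ⟨a₁, b₁, hab₁, hI₁⟩ := QLC.exists_closure_rangeOf_eq_Icc L.FN₁ h2N₁.1 h2N₁.2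
  obtain ⟨a₂, b₂, hab₂, hI₂⟩ := QLC.exists_closure_rangeOf_eq_Icc L.FN₂ h2N₂.1 h2N₂.2
  have hden : ∀ p ∈ S₁ ×ˢ S₂, L.den p.1 ≠ 0 := fun p hp => (h1 p.1 hp.1 p.2 hp.2).1
  have hA : ∀ p ∈ S₁ ×ˢ S₂, QLC.IsHurwitz (L.matA p.1 p.2) :=
    fun p hp => (h1 p.1 hp.1 p.2 hp.2).2
  have ha₂ : a₂ ∈ S₂ := by rw [hS₂, hI₂]; exact Set.left_mem_Icc.2 hab₂
  obtain ⟨σ, ρ, hσc, hρc, hstat⟩ := L.exists_continuousOn_inputStat hden hA hFr hFb hFd hσrd hσ₂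
    (hC.eventually_ne_zero hC0) (hP.eventually_ne_zero hP0)
  obtain ⟨δ, hδ, hK⟩ := L.exists_le_abs_gain_add_recip hC hP hC0 hP0
    (fun N₁ hN₁ => ⟨a₂, h1 N₁ hN₁ a₂ ha₂⟩) h2N₁.1 h4
  -- Here `c = μ_r / P_dc - μ_d`, so the root satisfies the fourth equation for all gains, not only
  -- at the fixed point.
  obtain ⟨μ, hμc, hμ⟩ := L.exists_continuousOn_mean hσc hρc (fun p hp => (hstat p hp).1)
    (fun p hp => (hstat p hp).2.1) hδ
    (fun μ₁ σ₁ ρ h h' => hK _ (subset_closure ⟨μ₁, σ₁, ρ, h, h', rfl⟩))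
    (QLC.recip Pdc * L.μr - L.μd)
  have hθ : ContinuousOn (fun p => (μ p, σ p, ρ p)) (S₁ ×ˢ S₂) := hμc.prodMk (hσc.prodMk hρc)
  have hm₁ : ∀ p ∈ S₁ ×ˢ S₂, L.FN₁ (μ p) (σ p) (ρ p) ∈ S₁ := fun p hp =>
    subset_closure ⟨_, _, _, (hstat p hp).1, (hstat p hp).2.1, rfl⟩
  have hm₂ : ∀ p ∈ S₁ ×ˢ S₂, L.FN₂ (μ p) (σ p) (ρ p) ∈ S₂ := fun p hp =>
    subset_closure ⟨_, _, _, (hstat p hp).1, (hstat p hp).2.1, rfl⟩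
  have hf₁ : ContinuousOn (fun p => L.FN₁ (μ p) (σ p) (ρ p)) (S₁ ×ˢ S₂) := fun p hp =>
    (L.continuousAt_FN₁ (μ p) (hstat p hp).1 (hstat p hp).2.1).comp_continuousWithinAt
      (f := fun p => (μ p, σ p, ρ p)) (hθ p hp)
  have hf₂ : ContinuousOn (fun p => L.FN₂ (μ p) (σ p) (ρ p)) (S₁ ×ˢ S₂) := fun p hp =>
    (L.continuousAt_FN₂ (μ p) (hstat p hp).1 (hstat p hp).2.1).comp_continuousWithinAt
      (f := fun p => (μ p, σ p, ρ p)) (hθ p hp)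
  obtain ⟨p, hp, e₁, e₂⟩ : ∃ p ∈ S₁ ×ˢ S₂,
      L.FN₁ (μ p) (σ p) (ρ p) = p.1 ∧ L.FN₂ (μ p) (σ p) (ρ p) = p.2 := by
    rw [hS₁, hS₂, hI₁, hI₂] at hf₁ hf₂ hm₁ hm₂ ⊢
    exact QLC.exists_fixedPoint_rectangle _ _ a₁ b₁ a₂ b₂ hab₁ hab₂ hf₁ hf₂ hm₁ hm₂
  obtain ⟨hσ, hρ, hin⟩ := hstat p hp
  have hNK : p.1 + K ≠ 0 := abs_pos.1 (hδ.trans_le (hK p.1 hp.1))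
  have hmean := hμ p hp
  refine ⟨p.1, hp.1, p.2, hp.2, L.FM (μ p) (σ p) (ρ p), subset_closure ⟨_, _, _, hσ, hρ, rfl⟩,
    μ p, σ p, ρ p, ⟨hNK, _, rfl, ?_⟩, hin, hρ, e₁.symm, e₂.symm, rfl, ?_⟩
  -- Substituting `m` cancels the `N₂ μ₂` terms and leaves `μ₁ (N₁ + K) = N₁ μ₁ - M + c`, which is
  -- the mean equation.
  · rw [eq_div_iff hNK]
    linear_combination hmean
  · linear_combination -hmean
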